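/- Let $d \ge 1$ and $\alpha_R \in (0,1)$. For every $n \ge 1$ let $n_R, n_B \ge 0$ be integers (depending on $n$) with $n_R + n_B = n$, and let $X_1,\dots,X_{n_R}$ (the red points) and $Y_1,\dots,Y_{n_B}$ (the blue points) be jointly independent random points, all uniformly distributed on $[0,1]^d$; nothing is assumed on the joint law for different $n$. Assume that $n_R/n \to \alpha_R$ as $n \to \infty$ (hence $n_B/n \to 1-\alpha_R$). For every $n$ with $n_R, n_B \ge 1$ let $T^n$ be the (almost surely unique) minimum spanning tree of the complete bipartite graph with independent sets $\{X_i\}_{i=1}^{n_R}$ and $\{Y_j\}_{j=1}^{n_B}$ and edge weights $w(X_i,Y_j) = |X_i - Y_j|$ (Euclidean distance), i.e. a spanning tree whose total edge weight is minimal among all connected spanning subgraphs, and let $\Delta(T^n)$ be its maximum vertex degree. Then the following hold. 1. There is a constant $C = C(d,\alpha_R) > 0$ such that $$\lim_{n\to\infty} P\left( C^{-1} < \frac{\Delta(T^n)}{\log n} < C \right) = 1 .$$ 2. For every $a > 0$ there is a constant $C = C(d,\alpha_R,a) > 0$ such that, for all sufficiently large $n$, $$P\left( \Delta(T^n) > C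 \log n \right) \le \frac{C}{n^{a}} .$$ 3. For every $q > 0$ there is a constant $C = C(d,\alpha_R,q) > 0$ such that, for all sufficiently large $n$, $$E\left[ \Delta(T^n)^q \right] \le C (\log n)^q .$$ The constants do not depend on the sequence $(n_R)_n$; how large $n$ has to be in 2 and 3 may depend on it. -/

import Mathlib

open MeasureTheory ProbabilityTheory Filter Topology

/-- Total weight of a graph `H` on a finite vertex set, with edge weights `w`. -/
noncomputable def graphCost {V : Type*} [Fintype V] (w : Sym2 V → ℝ) (H : SimpleGraph V) : ℝ :=
  open Classical in ∑ e ∈ H.edgeFinset, w e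

/-- `T` is a minimum spanning tree of the weighted graph `(G, w)`: a spanning tree contained in `G`
whose total weight is minimal among all connected spanning subgraphs of `G`. -/
structure IsMinSpanningTree {V : Type*} [Fintype V] (G : SimpleGraph V) (w : Sym2 V → ℝ)
    (T : SimpleGraph V) : Prop where
  le : T ≤ G
  isTree : T.IsTree
  minimal : ∀ H : SimpleGraph V, H ≤ G → H.Connected → graphCost w T ≤ graphCost w H

/-- The weight of an edge between two points of the finite families `x` (red) and `y` (blue):
their Euclidean distance. It is only used on the edges `{x i, y j}` of the complete bipartite
graph. -/
noncomputable def edgeLength {E ι κ : Type*} [PseudoMetricSpace E] (x : ι → E) (y : κ → E) :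
    Sym2 (ι ⊕ κ) → ℝ :=
  Sym2.lift ⟨fun u v => dist (Sum.elim x y u) (Sum.elim x y v), fun _ _ => dist_comm _ _⟩

/-- The maximum vertex degree of a graph on a finite vertex set. -/
noncomputable def maxVertexDegree {V : Type*} [Fintype V] (T : SimpleGraph V) : ℕ :=
  open Classical in T.maxDegree

/-- The cube `[0,1]^d` in Euclidean space. -/
def unitCube (d : ℕ) : Set (EuclideanSpace ℝ (Fin d)) :=
  {x | ∀ i, x i ∈ Set.Icc (0 : ℝ) 1}

/-- A sequence, indexed by the total number `n` of points, of random bipartite Euclidean minimum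
spanning trees in `[0,1]^d` with asymptotic fraction `αR` of red points. For each `n` the points
live on a probability space of their own, so nothing is assumed on the joint law for
different `n`. -/
structure RandomBipartiteMST (d : ℕ) (αR : ℝ) where
  /-- number of red points -/
  nR : ℕ → ℕ
  /-- number of blue points -/
  nB : ℕ → ℕ
  card_add : ∀ n, nR n + nB n = n
  tendsto_ratio : Tendsto (fun n : ℕ => (nR n : ℝ) / (n : ℝ)) atTop (𝓝 αR)
  /-- the underlying probability spaces -/
  Ω : ℕ → Type*
  [mΩ : ∀ n, MeasurableSpace (Ω n)]
  P : ∀ n, Measure (Ω n)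
  [isProb : ∀ n, IsProbabilityMeasure (P n)]
  /-- red points -/
  X : ∀ n, Fin (nR n) → Ω n → EuclideanSpace ℝ (Fin d)
  /-- blue points -/
  Y : ∀ n, Fin (nB n) → Ω n → EuclideanSpace ℝ (Fin d)
  /-- all points, red and blue, are jointly independent -/
  indep : ∀ n, iIndepFun (Sum.elim (X n) (Y n)) (P n)
  unif_X : ∀ n i, pdf.IsUniform (X n i) (unitCube d) (P n) volume
  unif_Y : ∀ n j, pdf.IsUniform (Y n j) (unitCube d) (P n) volume
  /-- the random tree, as a graph on the (indices of the) red and blue points -/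
  T : ∀ n, Ω n → SimpleGraph (Fin (nR n) ⊕ Fin (nB n))
  /-- Almost surely, the tree is a minimum spanning tree (there is one as soon as both colours
  occur, which is the case for all large `n` if `0 < αR < 1`). -/
  isMST : ∀ n, 0 < nR n → 0 < nB n → ∀ᵐ ω ∂(P n),
    IsMinSpanningTree (completeBipartiteGraph (Fin (nR n)) (Fin (nB n)))
      (edgeLength (fun i => X n i ω) (fun j => Y n j ω)) (T n ω)

attribute [instance] RandomBipartiteMST.mΩ RandomBipartiteMST.isProb

/-- The maximum vertex degree `Δ(T^n)` of the random tree. -/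
noncomputable def RandomBipartiteMST.Δ {d : ℕ} {αR : ℝ} (M : RandomBipartiteMST d αR) (n : ℕ)
    (ω : M.Ω n) : ℕ :=
  maxVertexDegree (M.T n ω)

/-!
The two bounds on the maximum degree rest on what a minimum spanning tree looks like at the scale
`(log n / n) ^ (1 / d)`. Both use the cycle property
`IsMinSpanningTree.weight_le_of_exchange`: an edge of the tree is no heavier than any edge of the
bipartite graph that reconnects the two parts left by its removal.

*Upper bound.* Cut the cube into about `n / (κ log n)` cells. For large `κ`, with probability
`1 - O(n ^ (-a))` every cell contains points of both colours, and only `O(log n)` points lie close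
to any cell. Since the cube is connected, density of both colours at a scale `ρ` gives a red-blue
edge shorter than `2 ρ` across every cut (`exists_short_edge_across_cut`), so all edges of the tree
are that short, and the degree of a vertex is at most the number of points close to it
(`IsMinSpanningTree.maxVertexDegree_lt`). The moment bound follows from this tail and `Δ ≤ n`.

*Lower bound.* A blue point is joined to its nearest red point
(`IsMinSpanningTree.adj_of_nearest`). So a red point in the middle of a cell, surrounded by `k` blue
points much closer to it than any other red point, has degree at least `k`. With about `4 n / log n`
cells one may take `k` of order `log n`, while the expected number of such clusters still grows
like a power of `n`. Clusters in different cells are almost uncorrelated, because they are described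
by exact occupation (`clusterEvent`) of disjoint sets, and the second moment method
(`pi_real_forall_notMem_clusterEvent_le`) shows that one exists with high probability.

The tree is an arbitrary function of `ω`, without any measurability. All events are therefore
enclosed in events that depend on the points only, and these are estimated under the product of the
uniform measures (`measure_le_pi_cubeMeasure`), which holds for outer measures.
-/

/-! ### Deterministic part: edges of a bipartite minimum spanning tree -/

theorem graphCost_eq_sum {V : Type*} [Fintype V] (w : Sym2 V → ℝ) {H : SimpleGraph V}
    {s : Finset (Sym2 V)} (hs : ∀ e, e ∈ s ↔ e ∈ H.edgeSet) :
    graphCost w H = ∑ e ∈ s, w e := by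
  classical
  unfold graphCost
  refine Finset.sum_congr ?_ fun _ _ => rfl
  ext e
  rw [hs, SimpleGraph.mem_edgeFinset]

/-- The cycle property: if an edge `uv` of a minimum spanning tree is removed, no edge of `G`
reconnecting the two parts is lighter than `uv`. -/
theorem IsMinSpanningTree.weight_le_of_exchange {V : Type*} [Fintype V] {G T : SimpleGraph V}
    {w : Sym2 V → ℝ} (h : IsMinSpanningTree G w T) {u v p q : V} (huv : T.Adj u v)
    (hpq : G.Adj p q) (hp : (T.deleteEdges {s(u, v)}).Reachable u p)
    (hq : (T.deleteEdges {s(u, v)}).Reachable v q) : w s(u, v) ≤ w s(p, q) := by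
  classical
  set D := T.deleteEdges {s(u, v)} with hD
  have hbr : ¬ D.Reachable u v := by
    have := (SimpleGraph.isAcyclic_iff_forall_adj_isBridge.1 h.isTree.isAcyclic) huv
    rwa [SimpleGraph.isBridge_iff] at this
  have hnD : ¬ D.Adj p q := fun hadj => hbr (hp.trans (hadj.reachable.trans hq.symm))
  have hne : p ≠ q := hpq.ne
  set H := D ⊔ SimpleGraph.edge p q with hH
  have hDH : D ≤ H := le_sup_left
  have hHpq : H.Adj p q := Or.inr (by simp [SimpleGraph.edge_adj, hne])
  have hHG : H ≤ G := by
    refine sup_le ((SimpleGraph.deleteEdges_le _).trans h.le) ?_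
    intro a b hab
    rw [SimpleGraph.edge_adj] at hab
    rcases hab.1 with ⟨rfl, rfl⟩ | ⟨rfl, rfl⟩
    · exact hpq
    · exact hpq.symm
  have huvH : H.Reachable u v :=
    (hp.mono hDH).trans (hHpq.reachable.trans (hq.mono hDH).symm)
  have hstep : ∀ a b, T.Adj a b → H.Reachable a b := by
    intro a b hab
    by_cases he : s(a, b) = s(u, v)
    · rcases Sym2.eq_iff.1 he with ⟨rfl, rfl⟩ | ⟨rfl, rfl⟩
      · exact huvH
      · exact huvH.symm
    · exact (hDH (show D.Adj a b by
        rw [hD, SimpleGraph.deleteEdges_adj]; exact ⟨hab, he⟩)).reachable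
  have hconn : H.Connected := by
    have hT := h.isTree.connected
    have := hT.nonempty
    refine ⟨fun a b => ?_⟩
    obtain ⟨W⟩ := hT.preconnected a b
    induction W with
    | nil => exact SimpleGraph.Reachable.refl _
    | cons hab _ ih => exact (hstep _ _ hab).trans ih
  have hmin := h.minimal H hHG hconn
  have hTs : graphCost w T = ∑ e ∈ T.edgeFinset, w e :=
    graphCost_eq_sum w fun e => SimpleGraph.mem_edgeFinset
  have hmemT : s(u, v) ∈ T.edgeFinset := by
    rw [SimpleGraph.mem_edgeFinset]; exact huv
  have hnot : s(p, q) ∉ T.edgeFinset.erase s(u, v) := by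
    intro hmem
    rw [Finset.mem_erase, SimpleGraph.mem_edgeFinset] at hmem
    exact hnD (by rw [hD, SimpleGraph.deleteEdges_adj]; exact ⟨hmem.2, hmem.1⟩)
  have hHs : graphCost w H = ∑ e ∈ insert s(p, q) (T.edgeFinset.erase s(u, v)), w e := by
    refine graphCost_eq_sum w fun e => ?_
    rw [hH, SimpleGraph.edgeSet_sup, SimpleGraph.edgeSet_edge_of_ne hne, hD,
      SimpleGraph.edgeSet_deleteEdges]
    simp [and_comm]
  rw [hTs, hHs, Finset.sum_insert hnot, ← Finset.add_sum_erase _ _ hmemT] at hmin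
  linarith

/-- Removing an edge `uv` of a connected graph leaves every vertex connected to `u` or to `v`. -/
theorem reachable_or_reachable_deleteEdges {V : Type*} {T : SimpleGraph V} (hT : T.Connected)
    (u v a : V) : (T.deleteEdges {s(u, v)}).Reachable u a ∨
      (T.deleteEdges {s(u, v)}).Reachable v a := by
  obtain ⟨W⟩ := hT.preconnected a u
  induction W with
  | nil => exact Or.inl (SimpleGraph.Reachable.refl _)
  | @cons a b c hab _ ih =>
    by_cases he : s(a, b) = s(c, v)
    · rcases Sym2.eq_iff.1 he with ⟨rfl, rfl⟩ | ⟨rfl, rfl⟩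
      · exact Or.inl (SimpleGraph.Reachable.refl _)
      · exact Or.inr (SimpleGraph.Reachable.refl _)
    · have hba : (T.deleteEdges {s(c, v)}).Reachable b a :=
        (SimpleGraph.Adj.reachable
          (by rw [SimpleGraph.deleteEdges_adj]; exact ⟨hab, he⟩)).symm
      exact ih.imp (fun h => h.trans hba) fun h => h.trans hba

section Geometry

variable {E ι κ : Type*} [PseudoMetricSpace E]

theorem edgeLength_mk (x : ι → E) (y : κ → E) (u v : ι ⊕ κ) :
    edgeLength x y s(u, v) = dist (Sum.elim x y u) (Sum.elim x y v) := rfl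

/-- If both colours are `ρ`-dense in a preconnected set, then every set of vertices that is
neither empty nor everything is left by a red-blue edge of length less than `2ρ`. -/
theorem exists_short_edge_across_cut {x : ι → E} {y : κ → E} {s : Set E} {ρ : ℝ}
    (hs : IsPreconnected s) (hx : ∀ i, x i ∈ s) (hy : ∀ j, y j ∈ s)
    (hred : ∀ a ∈ s, ∃ i, dist a (x i) < ρ) (hblue : ∀ a ∈ s, ∃ j, dist a (y j) < ρ)
    (S : Set (ι ⊕ κ)) {u v : ι ⊕ κ} (hu : u ∈ S) (hv : v ∉ S) :
    ∃ p q, (completeBipartiteGraph ι κ).Adj p q ∧ p ∈ S ∧ q ∉ S ∧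
      edgeLength x y s(p, q) < 2 * ρ := by
  by_contra! hcon
  -- A red and a blue vertex that are both close to a point lie on the same side of the cut.
  have hside : ∀ a i j, dist a (x i) < ρ → dist a (y j) < ρ → (Sum.inl i ∈ S ↔ Sum.inr j ∈ S) := by
    intro a i j hi hj
    have hd : dist (x i) (y j) < 2 * ρ := by
      have := dist_triangle_left (x i) (y j) a
      linarith
    constructor
    · intro h
      by_contra h'
      have := hcon (Sum.inl i) (Sum.inr j) (by simp) h h'
      rw [edgeLength_mk] at this
      exact absurd this (not_le.2 hd)
    · intro h
      by_contra h'
      have := hcon (Sum.inr j) (Sum.inl i) (by simp) h h'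
      rw [edgeLength_mk, dist_comm] at this
      exact absurd this (not_le.2 hd)
  have hloc : ∀ w : ι ⊕ κ, ∃ i, dist (Sum.elim x y w) (x i) < ρ ∧ (Sum.inl i ∈ S ↔ w ∈ S) := by
    rintro (i | j)
    · obtain ⟨i', hi'⟩ := hred _ (hx i)
      exact ⟨i, by simpa using dist_nonneg.trans_lt hi', Iff.rfl⟩
    · obtain ⟨i, hi⟩ := hred _ (hy j)
      exact ⟨i, hi, hside _ i j hi (by simpa using dist_nonneg.trans_lt hi)⟩
  have hmem : ∀ w : ι ⊕ κ, Sum.elim x y w ∈ s := by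
    rintro (i | j)
    exacts [hx i, hy j]
  let U : Set E := ⋃ i ∈ {i | Sum.inl i ∈ S}, Metric.ball (x i) ρ
  let W : Set E := ⋃ i ∈ {i | Sum.inl i ∉ S}, Metric.ball (x i) ρ
  have hU : IsOpen U := isOpen_biUnion fun _ _ => Metric.isOpen_ball
  have hW : IsOpen W := isOpen_biUnion fun _ _ => Metric.isOpen_ball
  have hcov : s ⊆ U ∪ W := by
    intro a ha
    obtain ⟨i, hi⟩ := hred a ha
    by_cases hiS : Sum.inl i ∈ S
    · exact Or.inl (Set.mem_biUnion (show i ∈ {i | Sum.inl i ∈ S} from hiS) hi)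
    · exact Or.inr (Set.mem_biUnion (show i ∈ {i | Sum.inl i ∉ S} from hiS) hi)
  obtain ⟨i, hi, hiS⟩ := hloc u
  obtain ⟨i', hi', hiS'⟩ := hloc v
  obtain ⟨a, ha, haU, haW⟩ := hs U W hU hW hcov
    ⟨_, hmem u, Set.mem_biUnion (show i ∈ {i | Sum.inl i ∈ S} from hiS.2 hu) hi⟩
    ⟨_, hmem v, Set.mem_biUnion (show i' ∈ {i | Sum.inl i ∉ S} from fun h => hv (hiS'.1 h)) hi'⟩
  simp only [U, W, Set.mem_iUnion, Set.mem_ofPred_eq, Metric.mem_ball, exists_prop] at haU haW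
  obtain ⟨i₁, h₁, hd₁⟩ := haU
  obtain ⟨i₂, h₂, hd₂⟩ := haW
  obtain ⟨j, hj⟩ := hblue a ha
  exact h₂ ((hside a i₂ j hd₂ hj).2 ((hside a i₁ j hd₁ hj).1 h₁))

/-- If both colours are `ρ`-dense in a preconnected set containing all points, then all edges of
the minimum spanning tree are shorter than `2ρ`. -/
theorem IsMinSpanningTree.dist_lt_of_dense [Fintype ι] [Fintype κ]
    {x : ι → E} {y : κ → E} {s : Set E} {ρ : ℝ}
    {T : SimpleGraph (ι ⊕ κ)}
    (hT : IsMinSpanningTree (completeBipartiteGraph ι κ) (edgeLength x y) T)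
    (hs : IsPreconnected s) (hx : ∀ i, x i ∈ s) (hy : ∀ j, y j ∈ s)
    (hred : ∀ a ∈ s, ∃ i, dist a (x i) < ρ) (hblue : ∀ a ∈ s, ∃ j, dist a (y j) < ρ)
    {u v : ι ⊕ κ} (huv : T.Adj u v) :
    dist (Sum.elim x y u) (Sum.elim x y v) < 2 * ρ := by
  have hbr : ¬ (T.deleteEdges {s(u, v)}).Reachable u v := by
    have := (SimpleGraph.isAcyclic_iff_forall_adj_isBridge.1 hT.isTree.isAcyclic) huv
    rwa [SimpleGraph.isBridge_iff] at this
  obtain ⟨p, q, hpq, hp, hq, hlt⟩ := exists_short_edge_across_cut hs hx hy hred hblue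
    {a | (T.deleteEdges {s(u, v)}).Reachable u a} (SimpleGraph.Reachable.refl u) hbr
  have hq' := (reachable_or_reachable_deleteEdges hT.isTree.connected u v q).resolve_left hq
  exact (hT.weight_le_of_exchange huv hpq hp hq').trans_lt hlt

/-- A blue point with a unique nearest red point is joined to it in the minimum spanning tree. -/
theorem IsMinSpanningTree.adj_of_nearest [Fintype ι] [Fintype κ]
    {x : ι → E} {y : κ → E}
    {T : SimpleGraph (ι ⊕ κ)}
    (hT : IsMinSpanningTree (completeBipartiteGraph ι κ) (edgeLength x y) T) {i : ι} {j : κ}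
    (hnear : ∀ i', i' ≠ i → dist (y j) (x i) < dist (y j) (x i')) :
    T.Adj (Sum.inl i) (Sum.inr j) := by
  classical
  obtain ⟨W, hW⟩ := (hT.isTree.connected.preconnected (Sum.inr j) (Sum.inl i)).exists_isPath
  cases W with
  | @cons _ b _ hab W' =>
    rcases b with i' | j'
    · by_cases hii : i' = i
      · subst hii; exact hab.symm
      · rw [SimpleGraph.Walk.cons_isPath_iff] at hW
        -- The rest of the path avoids `y j`, so it survives the removal of its first edge.
        have hreach : (T.deleteEdges {s(Sum.inr j, Sum.inl i')}).Reachable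
            (Sum.inl i') (Sum.inl i) :=
          ⟨W'.toDeleteEdges _ (by
            rintro e he rfl
            exact hW.2 (W'.fst_mem_support_of_mem_edges he))⟩
        have := hT.weight_le_of_exchange hab (p := Sum.inr j) (q := Sum.inl i) (by simp)
          (SimpleGraph.Reachable.refl _) hreach
        rw [edgeLength_mk, edgeLength_mk] at this
        exact absurd this (not_le.2 (hnear i' hii))
    · have := hT.le hab
      simp at this

end Geometry

theorem maxVertexDegree_le {V : Type*} [Fintype V] {T : SimpleGraph V} {K : ℕ}
    (h : ∀ u, ∃ s : Finset V, s.card ≤ K ∧ ∀ v, T.Adj u v → v ∈ s) : maxVertexDegree T ≤ K := by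
  classical
  unfold maxVertexDegree
  refine SimpleGraph.maxDegree_le_of_forall_degree_le _ _ fun u => ?_
  obtain ⟨s, hs, hsub⟩ := h u
  rw [← SimpleGraph.card_neighborFinset_eq_degree]
  exact (Finset.card_le_card fun v hv => hsub v (by simpa using hv)).trans hs

theorem maxVertexDegree_le_card {V : Type*} [Fintype V] (T : SimpleGraph V) :
    maxVertexDegree T ≤ Fintype.card V :=
  maxVertexDegree_le fun _ => ⟨Finset.univ, le_rfl, fun _ _ => Finset.mem_univ _⟩

theorem card_le_maxVertexDegree {V : Type*} [Fintype V] {T : SimpleGraph V} {s : Finset V} (u : V)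
    (h : ∀ v ∈ s, T.Adj u v) : s.card ≤ maxVertexDegree T := by
  classical
  unfold maxVertexDegree
  refine le_trans ?_ (SimpleGraph.degree_le_maxDegree _ u)
  rw [← SimpleGraph.card_neighborFinset_eq_degree]
  exact Finset.card_le_card fun v hv => by simpa using h v hv

/-! ### Cubes in Euclidean space -/

/-- The closed cube with centre `c` and half side `r`. -/
def closedCube {d : ℕ} (c : EuclideanSpace ℝ (Fin d)) (r : ℝ) : Set (EuclideanSpace ℝ (Fin d)) :=
  {x | ∀ i, |x i - c i| ≤ r}

theorem closedCube_eq_preimage {d : ℕ} (c : EuclideanSpace ℝ (Fin d)) (r : ℝ) :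
    closedCube c r = WithLp.ofLp ⁻¹' Set.Icc (fun i => c i - r) (fun i => c i + r) := by
  ext x
  simp only [closedCube, Set.mem_ofPred_eq, Set.mem_preimage, Set.mem_Icc, Pi.le_def, abs_le]
  constructor
  · intro h
    exact ⟨fun i => by linarith [(h i).1], fun i => by linarith [(h i).2]⟩
  · intro h i
    exact ⟨by linarith [h.1 i], by linarith [h.2 i]⟩

theorem measurableSet_closedCube {d : ℕ} (c : EuclideanSpace ℝ (Fin d)) (r : ℝ) :
    MeasurableSet (closedCube c r) := by
  rw [closedCube_eq_preimage]
  exact (PiLp.volume_preserving_ofLp (Fin d)).measurable measurableSet_Icc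

theorem volume_closedCube {d : ℕ} (c : EuclideanSpace ℝ (Fin d)) (r : ℝ) :
    volume (closedCube c r) = ENNReal.ofReal (2 * r) ^ d := by
  rw [closedCube_eq_preimage, (PiLp.volume_preserving_ofLp (Fin d)).measure_preimage
    measurableSet_Icc.nullMeasurableSet, Real.volume_Icc_pi]
  have : ∀ i, c i + r - (c i - r) = 2 * r := fun i => by ring
  simp [this]

theorem unitCube_eq_closedCube (d : ℕ) :
    unitCube d = closedCube (WithLp.toLp 2 fun _ => 1 / 2) (1 / 2) := by
  ext x
  simp only [unitCube, closedCube, Set.mem_ofPred_eq, Set.mem_Icc, abs_le]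
  refine forall_congr' fun i => ?_
  constructor <;> intro h <;> constructor <;> linarith [h.1, h.2]

theorem volume_unitCube (d : ℕ) : volume (unitCube d) = 1 := by
  rw [unitCube_eq_closedCube, volume_closedCube]
  norm_num

theorem measurableSet_unitCube (d : ℕ) : MeasurableSet (unitCube d) := by
  rw [unitCube_eq_closedCube]
  exact measurableSet_closedCube _ _

theorem isPreconnected_unitCube (d : ℕ) : IsPreconnected (unitCube d) := by
  refine Convex.isPreconnected ?_
  intro x hx y hy a b ha hb hab i
  exact convex_Icc (0 : ℝ) 1 (hx i) (hy i) ha hb hab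

/-- The uniform distribution on `[0,1]^d`. -/
noncomputable def cubeMeasure (d : ℕ) : Measure (EuclideanSpace ℝ (Fin d)) :=
  ProbabilityTheory.cond volume (unitCube d)

theorem cubeMeasure_eq (d : ℕ) : cubeMeasure d = volume.restrict (unitCube d) := by
  rw [cubeMeasure, ProbabilityTheory.cond, volume_unitCube]
  simp

instance (d : ℕ) : IsProbabilityMeasure (cubeMeasure d) := by
  refine ⟨?_⟩
  rw [cubeMeasure_eq, Measure.restrict_apply_univ, volume_unitCube]

theorem cubeMeasure_real_closedCube_le {d : ℕ} (c : EuclideanSpace ℝ (Fin d)) {r : ℝ}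
    (hr : 0 ≤ r) : (cubeMeasure d).real (closedCube c r) ≤ (2 * r) ^ d := by
  rw [cubeMeasure_eq, Measure.real]
  refine ENNReal.toReal_le_of_le_ofReal (by positivity) ?_
  refine (Measure.restrict_apply_le _ _).trans ?_
  rw [volume_closedCube, ENNReal.ofReal_pow (by positivity)]

theorem cubeMeasure_real_closedCube {d : ℕ} {c : EuclideanSpace ℝ (Fin d)} {r : ℝ}
    (hr : 0 ≤ r) (h : closedCube c r ⊆ unitCube d) :
    (cubeMeasure d).real (closedCube c r) = (2 * r) ^ d := by
  rw [cubeMeasure_eq, Measure.real, Measure.restrict_apply (measurableSet_closedCube c r),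
    Set.inter_eq_left.2 h, volume_closedCube, ENNReal.toReal_pow, ENNReal.toReal_ofReal]
  positivity

theorem ae_mem_unitCube (d : ℕ) : ∀ᵐ x ∂(cubeMeasure d), x ∈ unitCube d := by
  rw [cubeMeasure_eq]
  exact ae_restrict_mem (measurableSet_unitCube d)

theorem abs_sub_apply_le_dist {d : ℕ} (x y : EuclideanSpace ℝ (Fin d)) (i : Fin d) :
    |x i - y i| ≤ dist x y := by
  rw [dist_eq_norm]
  exact PiLp.norm_apply_le (x - y) i

theorem dist_le_of_forall_abs_sub_le {d : ℕ} {x y : EuclideanSpace ℝ (Fin d)} {r : ℝ}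
    (hr : 0 ≤ r) (h : ∀ i, |x i - y i| ≤ r) : dist x y ≤ d * r := by
  rw [EuclideanSpace.dist_eq]
  refine Real.sqrt_le_iff.2 ⟨by positivity, ?_⟩
  calc ∑ i, dist (x i) (y i) ^ 2 ≤ ∑ _i : Fin d, r ^ 2 := by
        refine Finset.sum_le_sum fun i _ => ?_
        rw [Real.dist_eq]
        exact pow_le_pow_left₀ (abs_nonneg _) (h i) 2
    _ = d * r ^ 2 := by simp
    _ ≤ (d * r) ^ 2 := by
        rw [mul_pow]
        gcongr
        rcases Nat.eq_zero_or_pos d with rfl | hd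
        · simp
        · have : (1 : ℝ) ≤ d := by exact_mod_cast hd
          nlinarith

/-- The centre of the cell with index `k` in the subdivision of `[0,1]^d` into `m ^ d` cubes of
side `1 / m`. -/
noncomputable def cellCenter {d : ℕ} (m : ℕ) (k : Fin d → Fin m) : EuclideanSpace ℝ (Fin d) :=
  WithLp.toLp 2 fun i => ((k i : ℝ) + 1 / 2) / m

theorem cellCenter_apply {d m : ℕ} (k : Fin d → Fin m) (i : Fin d) :
    cellCenter m k i = ((k i : ℝ) + 1 / 2) / m := rfl

theorem closedCube_cellCenter_subset {d m : ℕ} (k : Fin d → Fin m) {r : ℝ}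
    (hr : r ≤ 1 / (2 * m)) : closedCube (cellCenter m k) r ⊆ unitCube d := by
  intro x hx i
  have h := abs_le.1 (hx i)
  rw [cellCenter_apply] at h
  have hm : (0 : ℝ) < m := by exact_mod_cast (k i).pos
  have h1 : ((k i : ℕ) : ℝ) + 1 ≤ m := by exact_mod_cast (k i).isLt
  have e1 : ((k i : ℝ) + 1 / 2) / m = (k i : ℝ) / m + 1 / (2 * m) := by field_simp
  have e2 : ((k i : ℝ) + 1) / m = (k i : ℝ) / m + 1 / (2 * m) + 1 / (2 * m) := by
    field_simp; ring
  have h2 : ((k i : ℝ) + 1) / m ≤ 1 := by rw [div_le_one hm]; exact h1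
  have h3 : 0 ≤ (k i : ℝ) / m := by positivity
  constructor <;> linarith [h.1, h.2]

/-- The cells cover the unit cube. -/
theorem exists_mem_cell {d m : ℕ} (hm : 0 < m) {x : EuclideanSpace ℝ (Fin d)}
    (hx : x ∈ unitCube d) : ∃ k : Fin d → Fin m, x ∈ closedCube (cellCenter m k) (1 / (2 * m)) := by
  have hm' : (0 : ℝ) < m := by exact_mod_cast hm
  have key : ∀ t : ℝ, t ∈ Set.Icc (0 : ℝ) 1 →
      ∃ k : Fin m, |t - ((k : ℝ) + 1 / 2) / m| ≤ 1 / (2 * m) := by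
    intro t ht
    have e1 : ∀ k : ℝ, (k + 1 / 2) / m = k / m + 1 / (2 * m) := fun k => by field_simp
    have e3 : (1 : ℝ) / m = 1 / (2 * m) + 1 / (2 * m) := by field_simp; norm_num
    have htm : 0 ≤ t * m := mul_nonneg ht.1 hm'.le
    by_cases hlt : ⌊t * m⌋₊ < m
    · refine ⟨⟨_, hlt⟩, ?_⟩
      have h1 : (⌊t * m⌋₊ : ℝ) / m ≤ t := by
        rw [div_le_iff₀ hm']; exact Nat.floor_le htm
      have h2 : t ≤ (⌊t * m⌋₊ : ℝ) / m + 1 / m := by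
        rw [← add_div, le_div_iff₀ hm']; exact (Nat.lt_floor_add_one _).le
      rw [abs_le, e1]
      constructor <;> simp only <;> linarith
    · -- The floor reaches `m` only at the right end point, which belongs to the last cell.
      have h1 : (m : ℝ) ≤ t * m := (Nat.le_floor_iff htm).1 (not_lt.1 hlt)
      have ht1 : t = 1 := le_antisymm ht.2 (by
        by_contra hc
        push Not at hc
        nlinarith)
      refine ⟨⟨m - 1, by omega⟩, ?_⟩
      have : ((m - 1 : ℕ) : ℝ) = m - 1 := by rw [Nat.cast_sub hm]; simp
      have e4 : ((m : ℝ) - 1) / m = 1 - 1 / m := by field_simp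
      have hpos : (0 : ℝ) < 1 / (2 * m) := by positivity
      rw [abs_le, e1]
      simp only [this, e4]
      constructor <;> linarith
  choose k hk using fun i => key (x i) (hx i)
  exact ⟨k, hk⟩

/-- The cubes of half the side around the cell centres are disjoint. -/
theorem disjoint_closedCube_cellCenter {d m : ℕ} {k l : Fin d → Fin m} (hkl : k ≠ l) :
    Disjoint (closedCube (cellCenter m k) (1 / (4 * m)))
      (closedCube (cellCenter m l) (1 / (4 * m))) := by
  rw [Set.disjoint_left]
  intro x hxk hxl
  obtain ⟨i, hi⟩ := Function.ne_iff.1 hkl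
  have hm : (0 : ℝ) < m := by exact_mod_cast (k i).pos
  have hki := hxk i
  have hli := hxl i
  rw [cellCenter_apply] at hki hli
  have h1 : |((k i : ℝ) + 1 / 2) / m - ((l i : ℝ) + 1 / 2) / m| ≤ 1 / (2 * m) := by
    have e : (1 : ℝ) / (2 * m) = 1 / (4 * m) + 1 / (4 * m) := by field_simp; norm_num
    rw [e]
    refine (abs_sub_le _ (x i) _).trans (add_le_add ?_ hli)
    rwa [abs_sub_comm]
  have h2 : ((k i : ℝ) + 1 / 2) / m - ((l i : ℝ) + 1 / 2) / m = ((k i : ℝ) - l i) / m := by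
    field_simp; ring
  rw [h2, abs_div, abs_of_pos hm, div_le_div_iff₀ hm (by positivity)] at h1
  have h3 : |(k i : ℝ) - l i| < 1 := by nlinarith
  have h4 : |((k i : ℕ) : ℤ) - ((l i : ℕ) : ℤ)| < 1 := by exact_mod_cast h3
  rw [Int.abs_lt_one_iff] at h4
  exact hi (Fin.ext (by omega))

/-! ### Independent points with a common law -/

/-- The second moment method for a finite family of events. -/
theorem measureReal_forall_notMem_mul_sq_le {Ω ι : Type*} [MeasurableSpace Ω] [Fintype ι]
    (P : Measure Ω) [IsProbabilityMeasure P] {A : ι → Set Ω} (hA : ∀ i, MeasurableSet (A i)) :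
    P.real {ω | ∀ i, ω ∉ A i} * (∑ i, P.real (A i)) ^ 2 ≤
      (∑ i, ∑ j, P.real (A i ∩ A j)) - (∑ i, P.real (A i)) ^ 2 := by
  classical
  set m := ∑ i, P.real (A i) with hm
  let F : Ω → ℝ := fun ω => ∑ i, (A i).indicator 1 ω
  have hint : ∀ s : Set Ω, MeasurableSet s → Integrable (s.indicator (1 : Ω → ℝ)) P :=
    fun s hs => (integrable_const (1 : ℝ)).indicator hs
  have hF : Integrable F P := integrable_finsetSum _ fun i _ => hint _ (hA i)
  have hF2 : (fun ω => F ω ^ 2) = fun ω => ∑ i, ∑ j, (A i ∩ A j).indicator (1 : Ω → ℝ) ω := by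
    ext ω
    simp only [F, sq, Finset.sum_mul_sum]
    refine Finset.sum_congr rfl fun i _ => Finset.sum_congr rfl fun j _ => ?_
    rw [Set.inter_indicator_one]; rfl
  have hF2i : Integrable (fun ω => F ω ^ 2) P := by
    rw [hF2]
    exact integrable_finsetSum _ fun i _ => integrable_finsetSum _ fun j _ =>
      hint _ ((hA i).inter (hA j))
  have hIF : ∫ ω, F ω ∂P = m := by
    rw [integral_finsetSum _ fun i _ => hint _ (hA i)]
    exact Finset.sum_congr rfl fun i _ => integral_indicator_one (hA i)
  have hIF2 : ∫ ω, F ω ^ 2 ∂P = ∑ i, ∑ j, P.real (A i ∩ A j) := by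
    rw [hF2, integral_finsetSum _ fun i _ => integrable_finsetSum _ fun j _ =>
      hint _ ((hA i).inter (hA j))]
    refine Finset.sum_congr rfl fun i _ => ?_
    rw [integral_finsetSum _ fun j _ => hint _ ((hA i).inter (hA j))]
    exact Finset.sum_congr rfl fun j _ => integral_indicator_one ((hA i).inter (hA j))
  have hZ : MeasurableSet {ω | ∀ i, ω ∉ A i} := by
    have : {ω | ∀ i, ω ∉ A i} = ⋂ i, (A i)ᶜ := by ext; simp
    rw [this]
    exact MeasurableSet.iInter fun i => (hA i).compl
  have hvar : ∫ ω, (F ω - m) ^ 2 ∂P = (∑ i, ∑ j, P.real (A i ∩ A j)) - m ^ 2 := by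
    have e : (fun ω => (F ω - m) ^ 2) = fun ω => F ω ^ 2 - (2 * m) * F ω + m ^ 2 := by
      ext ω; ring
    rw [e, integral_add (f := fun ω => F ω ^ 2 - 2 * m * F ω) (hF2i.sub (hF.const_mul _))
      (integrable_const _), integral_sub hF2i (hF.const_mul _), integral_const_mul, hIF, hIF2]
    simp
    ring
  rw [← hvar]
  have hle : ∫ ω, {ω | ∀ i, ω ∉ A i}.indicator (fun _ => m ^ 2) ω ∂P ≤ ∫ ω, (F ω - m) ^ 2 ∂P := by
    refine integral_mono ((integrable_const _).indicator hZ) ?_ fun ω => ?_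
    · have e : (fun ω => (F ω - m) ^ 2) = fun ω => F ω ^ 2 - (2 * m) * F ω + m ^ 2 := by
        ext ω; ring
      rw [e]
      exact (hF2i.sub (hF.const_mul _)).add (integrable_const _)
    · by_cases hω : ω ∈ {ω | ∀ i, ω ∉ A i}
      · have : F ω = 0 := Finset.sum_eq_zero fun i _ => Set.indicator_of_notMem (hω i) _
        simp only [Set.indicator_of_mem hω, this]
        nlinarith
      · simp only [Set.indicator_of_notMem hω]
        positivity
  rwa [integral_indicator_const _ hZ, smul_eq_mul] at hle

/-- The event that precisely the points with labels in `W` lie in `B`, and these even in its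
subset `A`. -/
def clusterEvent {E V : Type*} (A B : Set E) (W : Finset V) : Set (V → E) :=
  {z | (∀ v ∈ W, z v ∈ A) ∧ ∀ v ∉ W, z v ∉ B}

theorem clusterEvent_eq {E V : Type*} [DecidableEq V] (A B : Set E) (W : Finset V) :
    clusterEvent A B W = {z | ∀ v, z v ∈ (if v ∈ W then A else Bᶜ : Set E)} := by
  ext z
  constructor
  · intro h v
    by_cases hv : v ∈ W
    · simpa [hv] using h.1 v hv
    · simpa [hv] using h.2 v hv
  · intro h
    refine ⟨fun v hv => by simpa [hv] using h v, fun v hv => by simpa [hv] using h v⟩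

/-- Two cluster events on the same pair of sets exclude each other, unless they refer to the same
labels. -/
theorem clusterEvent_inter_eq_empty {E V : Type*} {A B : Set E} (hAB : A ⊆ B) {W W' : Finset V}
    (hne : W ≠ W') : clusterEvent A B W ∩ clusterEvent A B W' = ∅ := by
  refine Set.eq_empty_of_forall_notMem fun z hz => hne (Finset.ext fun v => ?_)
  constructor
  · intro hv
    by_contra hv'
    exact hz.2.2 v hv' (hAB (hz.1.1 v hv))
  · intro hv
    by_contra hv'
    exact hz.1.2 v hv' (hAB (hz.2.1 v hv))

section Iid

variable {E V : Type*} [MeasurableSpace E] [Fintype V] (μ : Measure E) [IsProbabilityMeasure μ]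

theorem pi_real_forall_mem (s : V → Set E) :
    (Measure.pi fun _ : V => μ).real {z | ∀ v, z v ∈ s v} = ∏ v, μ.real (s v) := by
  have : {z : V → E | ∀ v, z v ∈ s v} = Set.univ.pi s := by ext; simp
  rw [this, Measure.real, Measure.pi_pi, ENNReal.toReal_prod]
  rfl

theorem pi_real_forall_mem_finset [DecidableEq V] (S : Finset V) (A : Set E) :
    (Measure.pi fun _ : V => μ).real {z | ∀ v ∈ S, z v ∈ A} = μ.real A ^ S.card := by
  have : {z : V → E | ∀ v ∈ S, z v ∈ A} =
      {z | ∀ v, z v ∈ (if v ∈ S then A else Set.univ : Set E)} := by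
    ext z
    refine forall_congr' fun v => ?_
    by_cases hv : v ∈ S <;> simp [hv]
  rw [this, pi_real_forall_mem]
  have h : ∀ v, μ.real (if v ∈ S then A else Set.univ : Set E) =
      if v ∈ S then μ.real A else 1 := by
    intro v
    split_ifs
    · rfl
    · exact probReal_univ
  simp_rw [h]
  rw [Finset.prod_ite]
  simp

/-- A set of measure `μ A` is missed by all points with labels in `S` with probability at most
`exp (-|S| μ A)`. -/
theorem pi_real_forall_notMem_le [DecidableEq V] (S : Finset V) {A : Set E}
    (hA : MeasurableSet A) :
    (Measure.pi fun _ : V => μ).real {z | ∀ v ∈ S, z v ∉ A} ≤ Real.exp (-(S.card * μ.real A)) := by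
  have := pi_real_forall_mem_finset μ S Aᶜ
  simp only [Set.mem_compl_iff] at this
  rw [this, probReal_compl_eq_one_sub hA]
  calc (1 - μ.real A) ^ S.card ≤ Real.exp (-μ.real A) ^ S.card := by
        refine pow_le_pow_left₀ (by linarith [measureReal_le_one (μ := μ) (s := A)]) ?_ _
        linarith [Real.add_one_le_exp (-μ.real A)]
    _ = Real.exp (-(S.card * μ.real A)) := by
        rw [← Real.exp_nat_mul]; ring_nf

/-- The probability that at least `K` points fall into `A` is at most `exp (-K)` once `K` exceeds
`e²` times the expected number. -/
theorem pi_real_le_card_mem_le [DecidableEq V] (A : Set E) {K : ℕ}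
    (hK : Real.exp 2 * (Fintype.card V * μ.real A) ≤ K) :
    (Measure.pi fun _ : V => μ).real {z | ∃ S : Finset V, S.card = K ∧ ∀ v ∈ S, z v ∈ A} ≤
      Real.exp (-K) := by
  have hset : {z : V → E | ∃ S : Finset V, S.card = K ∧ ∀ v ∈ S, z v ∈ A} =
      ⋃ S ∈ Finset.univ.powersetCard K, {z | ∀ v ∈ S, z v ∈ A} := by
    ext z; simp
  rw [hset]
  refine (measureReal_biUnion_finset_le _ _).trans ?_
  set β := μ.real A with hβ
  set n := Fintype.card V with hn
  have hβ0 : 0 ≤ β := measureReal_nonneg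
  have h1 : ∑ S ∈ (Finset.univ : Finset V).powersetCard K,
      (Measure.pi fun _ : V => μ).real {z | ∀ v ∈ S, z v ∈ A} = (n.choose K) * β ^ K := by
    rw [Finset.sum_congr rfl fun S hS => by
      rw [pi_real_forall_mem_finset, (Finset.mem_powersetCard.1 hS).2]]
    rw [Finset.sum_const, Finset.card_powersetCard, Finset.card_univ, nsmul_eq_mul]
  rw [h1]
  have h2 : (K : ℝ) ^ K / K.factorial ≤ Real.exp K :=
    Real.pow_div_factorial_le_exp (x := (K : ℝ)) (by positivity) K
  have hfac : (0 : ℝ) < K.factorial := by positivity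
  have h3 : (n * β) ^ K ≤ (Real.exp (-2) * K) ^ K := by
    refine pow_le_pow_left₀ (by positivity) ?_ _
    rw [Real.exp_neg, inv_mul_eq_div, le_div_iff₀ (Real.exp_pos 2)]
    linarith
  calc (n.choose K : ℝ) * β ^ K ≤ (n ^ K / K.factorial) * β ^ K := by
        gcongr; exact Nat.choose_le_pow_div K n
    _ = (n * β) ^ K / K.factorial := by rw [mul_pow]; ring
    _ ≤ (Real.exp (-2) * K) ^ K / K.factorial := by gcongr
    _ = Real.exp (-2) ^ K * ((K : ℝ) ^ K / K.factorial) := by rw [mul_pow]; ring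
    _ ≤ Real.exp (-2) ^ K * Real.exp K := by gcongr
    _ = Real.exp (-K) := by
        rw [← Real.exp_nat_mul, ← Real.exp_add]; ring_nf

theorem measurableSet_clusterEvent {A B : Set E} (hA : MeasurableSet A) (hB : MeasurableSet B)
    (W : Finset V) : MeasurableSet (clusterEvent A B W) := by
  classical
  have : clusterEvent A B W = ⋂ v, (fun z : V → E => z v) ⁻¹' (if v ∈ W then A else Bᶜ : Set E) := by
    rw [clusterEvent_eq]; ext; simp
  rw [this]
  refine MeasurableSet.iInter fun v => measurable_pi_apply v ?_
  split_ifs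
  exacts [hA, hB.compl]

theorem pi_real_clusterEvent {A B : Set E} (hB : MeasurableSet B) (W : Finset V) :
    (Measure.pi fun _ : V => μ).real (clusterEvent A B W) =
      μ.real A ^ W.card * (1 - μ.real B) ^ (Fintype.card V - W.card) := by
  classical
  rw [clusterEvent_eq, pi_real_forall_mem]
  simp_rw [apply_ite μ.real]
  rw [Finset.prod_ite, Finset.prod_const, Finset.prod_const, probReal_compl_eq_one_sub hB]
  congr 2
  · simp
  · rw [← Finset.card_compl]; congr 1; ext; simp

/-- Cluster events at disjoint places are almost negatively correlated. -/
theorem pi_real_clusterEvent_inter_le {A B A' B' : Set E} (hB : MeasurableSet B)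
    (hB' : MeasurableSet B') (hAB : A ⊆ B) (hAB' : A' ⊆ B') (hdisj : Disjoint B B') {α β : ℝ}
    (hα : μ.real A = α) (hα' : μ.real A' = α) (hβ : μ.real B = β) (hβ' : μ.real B' = β)
    (hβ1 : β < 1) {W W' : Finset V} {s : ℕ} (hW : W.card = s) (hW' : W'.card = s) :
    (Measure.pi fun _ : V => μ).real (clusterEvent A B W ∩ clusterEvent A' B' W') ≤
      (α ^ s * (1 - β) ^ (Fintype.card V - s)) ^ 2 * ((1 - β) ^ (2 * s))⁻¹ := by
  classical
  have hb : 0 < 1 - β := by linarith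
  by_cases hWW : Disjoint W W'
  · have hsub : clusterEvent A B W ∩ clusterEvent A' B' W' ⊆
        {z | ∀ v, z v ∈ (if v ∈ W then A else if v ∈ W' then A' else (B ∪ B')ᶜ : Set E)} := by
      rintro z ⟨h, h'⟩ v
      by_cases hv : v ∈ W
      · simpa [hv] using h.1 v hv
      · by_cases hv' : v ∈ W'
        · simpa [hv, hv'] using h'.1 v hv'
        · have h1 := h.2 v hv
          have h2 := h'.2 v hv'
          simp [hv, hv', h1, h2]
    refine (measureReal_mono hsub).trans ?_
    rw [pi_real_forall_mem]
    have hU : μ.real (B ∪ B')ᶜ ≤ (1 - β) ^ 2 := by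
      rw [probReal_compl_eq_one_sub (hB.union hB'), measureReal_union hdisj hB', hβ, hβ']
      nlinarith [sq_nonneg β]
    have hcard : (W ∪ W').card = 2 * s := by
      rw [Finset.card_union_of_disjoint hWW, hW, hW']; ring
    have hle : 2 * s ≤ Fintype.card V := hcard ▸ Finset.card_le_univ _
    calc ∏ v, μ.real (if v ∈ W then A else if v ∈ W' then A' else (B ∪ B')ᶜ : Set E)
        ≤ ∏ v, (if v ∈ W ∪ W' then α else (1 - β) ^ 2) := by
          refine Finset.prod_le_prod (fun _ _ => measureReal_nonneg) fun v _ => ?_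
          by_cases hv : v ∈ W
          · simp [hv, hα]
          · by_cases hv' : v ∈ W'
            · simp [hv, hv', hα']
            · simpa [hv, hv'] using hU
      _ = α ^ (2 * s) * ((1 - β) ^ 2) ^ (Fintype.card V - 2 * s) := by
          rw [Finset.prod_ite, Finset.prod_const, Finset.prod_const]
          congr 2
          · rw [← hcard]; congr 1; ext; simp
          · rw [← hcard, ← Finset.card_compl]; congr 1; ext; simp
      _ = (α ^ s * (1 - β) ^ (Fintype.card V - s)) ^ 2 * ((1 - β) ^ (2 * s))⁻¹ := by
          obtain ⟨r, hr⟩ := Nat.exists_eq_add_of_le hle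
          have e1 : Fintype.card V - 2 * s = r := by omega
          have e2 : Fintype.card V - s = r + s := by omega
          rw [e1, e2]
          field_simp
          generalize 1 - β = c
          ring
  · obtain ⟨v, hv, hv'⟩ := Finset.not_disjoint_iff.1 hWW
    have : clusterEvent A B W ∩ clusterEvent A' B' W' = ∅ :=
      Set.eq_empty_of_forall_notMem fun z hz =>
        Set.disjoint_left.1 hdisj (hAB (hz.1.1 v hv)) (hAB' (hz.2.1 v hv'))
    rw [this, measureReal_empty]
    positivity

/-- By the second moment method, the probability that none of the cluster events at disjoint
places `B j` occurs is small once their expected number is large. -/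
theorem pi_real_forall_notMem_clusterEvent_le {J I : Type*} [Fintype J] [Fintype I] [Nonempty J]
    [Nonempty I] {A B : J → Set E} (hA : ∀ j, MeasurableSet (A j)) (hB : ∀ j, MeasurableSet (B j))
    (hAB : ∀ j, A j ⊆ B j) (hdisj : ∀ j j', j ≠ j' → Disjoint (B j) (B j')) {α β : ℝ}
    (hα : ∀ j, μ.real (A j) = α) (hβ : ∀ j, μ.real (B j) = β) (hα0 : 0 < α) (hβ1 : β < 1)
    {W : I → Finset V} (hW : Function.Injective W) {s : ℕ} (hs : ∀ i, (W i).card = s) :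
    (Measure.pi fun _ : V => μ).real {z | ∀ j i, z ∉ clusterEvent (A j) (B j) (W i)} ≤
      (Fintype.card J * Fintype.card I * (α ^ s * (1 - β) ^ (Fintype.card V - s)))⁻¹ +
        (((1 - β) ^ (2 * s))⁻¹ - 1) := by
  classical
  have hb : 0 < 1 - β := by linarith
  set ν := Measure.pi fun _ : V => μ
  set p := α ^ s * (1 - β) ^ (Fintype.card V - s) with hp
  set b := ((1 - β) ^ (2 * s))⁻¹ with hb'
  have hp0 : 0 < p := by positivity
  have hJ : (0 : ℝ) < Fintype.card J := by exact_mod_cast Fintype.card_pos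
  have hI : (0 : ℝ) < Fintype.card I := by exact_mod_cast Fintype.card_pos
  let C : J × I → Set (V → E) := fun t => clusterEvent (A t.1) (B t.1) (W t.2)
  have hC : ∀ t, ν.real (C t) = p := fun t => by
    rw [pi_real_clusterEvent μ (hB _), hα, hβ, hs]
  have hsum : ∑ t, ν.real (C t) = Fintype.card J * Fintype.card I * p := by
    simp [hC]
  have hpair : ∀ t t', ν.real (C t ∩ C t') ≤ (if t = t' then p else 0) + p ^ 2 * b := by
    intro t t'
    by_cases htt : t = t'
    · subst htt
      simp only [Set.inter_self, hC, if_true]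
      have : 0 ≤ p ^ 2 * b := by positivity
      linarith
    · rw [if_neg htt, zero_add]
      by_cases hj : t.1 = t'.1
      · have hi : W t.2 ≠ W t'.2 := fun h => htt (Prod.ext hj (hW h))
        have : C t ∩ C t' = ∅ := by
          simp only [C, hj]
          exact clusterEvent_inter_eq_empty (hAB _) hi
        rw [this, measureReal_empty]
        positivity
      · exact pi_real_clusterEvent_inter_le μ (hB _) (hB _) (hAB _) (hAB _) (hdisj _ _ hj) (hα _)
          (hα _) (hβ _) (hβ _) hβ1 (hs _) (hs _)
  have hsq := measureReal_forall_notMem_mul_sq_le ν (A := C)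
    fun t => measurableSet_clusterEvent (hA _) (hB _) _
  have hpairs : ∑ t, ∑ t', ν.real (C t ∩ C t') ≤
      Fintype.card J * Fintype.card I * p + (Fintype.card J * Fintype.card I * p) ^ 2 * b := by
    calc ∑ t, ∑ t', ν.real (C t ∩ C t')
        ≤ ∑ t : J × I, ∑ t' : J × I, ((if t = t' then p else 0) + p ^ 2 * b) :=
          Finset.sum_le_sum fun t _ => Finset.sum_le_sum fun t' _ => hpair t t'
      _ = _ := by
          simp only [Finset.sum_add_distrib, Finset.sum_ite_eq, Finset.mem_univ, if_true,
            Finset.sum_const, Finset.card_univ, Fintype.card_prod, nsmul_eq_mul]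
          push_cast
          ring
  have hset : {z : V → E | ∀ j i, z ∉ clusterEvent (A j) (B j) (W i)} = {z | ∀ t, z ∉ C t} := by
    ext z; simp [C, Prod.forall]
  rw [hset]
  rw [hsum] at hsq
  set m := Fintype.card J * Fintype.card I * p
  have hm : 0 < m := by positivity
  have : ν.real {z | ∀ t, z ∉ C t} * m ^ 2 ≤ (m⁻¹ + (b - 1)) * m ^ 2 := by
    have e : (m⁻¹ + (b - 1)) * m ^ 2 = m + m ^ 2 * b - m ^ 2 := by field_simp; ring
    rw [e]
    linarith
  exact le_of_mul_le_mul_right this (by positivity)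

end Iid

/-! ### Degree bounds for a fixed number of points -/

section Deterministic

variable {d m : ℕ} {ι κ : Type*} [Fintype ι] [Fintype κ]

/-- If every cell of side `1 / m` contains points of both colours and no cell has `K` points
close to it, then all degrees are less than `K`. -/
theorem IsMinSpanningTree.maxVertexDegree_lt (hd : 1 ≤ d) (hm : 0 < m) {K : ℕ}
    {z : ι ⊕ κ → EuclideanSpace ℝ (Fin d)} {T : SimpleGraph (ι ⊕ κ)}
    (hT : IsMinSpanningTree (completeBipartiteGraph ι κ)
      (edgeLength (fun i => z (Sum.inl i)) fun j => z (Sum.inr j)) T)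
    (hz : ∀ v, z v ∈ unitCube d)
    (hred : ∀ k : Fin d → Fin m, ∃ i, z (Sum.inl i) ∈ closedCube (cellCenter m k) (1 / (2 * m)))
    (hblue : ∀ k : Fin d → Fin m, ∃ j, z (Sum.inr j) ∈ closedCube (cellCenter m k) (1 / (2 * m)))
    (hK : ∀ k : Fin d → Fin m, ¬ ∃ S : Finset (ι ⊕ κ), S.card = K ∧
      ∀ v ∈ S, z v ∈ closedCube (cellCenter m k) (5 * d / m)) :
    maxVertexDegree T < K := by
  classical
  have hm' : (0 : ℝ) < m := by exact_mod_cast hm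
  have hd' : (1 : ℝ) ≤ d := by exact_mod_cast hd
  have hK0 : 0 < K := by
    rcases Nat.eq_zero_or_pos K with rfl | h
    · exact (hK (fun _ => ⟨0, hm⟩) ⟨∅, rfl, by simp⟩).elim
    · exact h
  have hclose : ∀ (k : Fin d → Fin m) (a b : EuclideanSpace ℝ (Fin d)),
      a ∈ closedCube (cellCenter m k) (1 / (2 * m)) →
      b ∈ closedCube (cellCenter m k) (1 / (2 * m)) → dist a b < 2 * d / m := by
    intro k a b ha hb
    have h1 : dist a b ≤ d * (1 / m) := by
      refine dist_le_of_forall_abs_sub_le (by positivity) fun i => ?_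
      have e : (1 : ℝ) / m = 1 / (2 * m) + 1 / (2 * m) := by field_simp; norm_num
      rw [e]
      refine (abs_sub_le _ (cellCenter m k i) _).trans (add_le_add (ha i) ?_)
      rw [abs_sub_comm]
      exact hb i
    refine h1.trans_lt ?_
    rw [mul_one_div]
    gcongr
    linarith
  have helim : ∀ v, Sum.elim (fun i => z (Sum.inl i)) (fun j => z (Sum.inr j)) v = z v := by
    rintro (i | j) <;> rfl
  have hedge : ∀ u v, T.Adj u v → dist (z u) (z v) < 2 * (2 * d / m) := by
    intro u v huv
    have := hT.dist_lt_of_dense (isPreconnected_unitCube d) (fun i => hz _) (fun j => hz _)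
      (ρ := 2 * d / m) ?_ ?_ huv
    · rwa [helim, helim] at this
    · intro a ha
      obtain ⟨k, hk⟩ := exists_mem_cell hm ha
      obtain ⟨i, hi⟩ := hred k
      exact ⟨i, hclose k _ _ hk hi⟩
    · intro a ha
      obtain ⟨k, hk⟩ := exists_mem_cell hm ha
      obtain ⟨j, hj⟩ := hblue k
      exact ⟨j, hclose k _ _ hk hj⟩
  have hle : maxVertexDegree T ≤ K - 1 := by
    refine maxVertexDegree_le fun u => ?_
    obtain ⟨k, hk⟩ := exists_mem_cell hm (hz u)
    refine ⟨Finset.univ.filter fun v => z v ∈ closedCube (cellCenter m k) (5 * d / m), ?_, ?_⟩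
    · by_contra hcon
      obtain ⟨S, hS, hcard⟩ := Finset.exists_subset_card_eq (show K ≤ _ by
        exact Nat.le_of_pred_lt (not_le.1 hcon))
      exact hK k ⟨S, hcard, fun v hv => (Finset.mem_filter.1 (hS hv)).2⟩
    · intro v hv
      rw [Finset.mem_filter]
      refine ⟨Finset.mem_univ _, fun i => ?_⟩
      have h1 : |z v i - z u i| ≤ 2 * (2 * d / m) :=
        (abs_sub_apply_le_dist _ _ i).trans (by rw [dist_comm]; exact (hedge u v hv).le)
      have h2 := hk i
      have h3 : (1 : ℝ) / (2 * m) ≤ d / m := by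
        rw [div_le_div_iff₀ (by positivity) hm']; nlinarith
      have e : (5 * d / m : ℝ) = 2 * (2 * d / m) + d / m := by ring
      rw [e]
      exact (abs_sub_le _ (z u i) _).trans (add_le_add h1 (h2.trans h3))
  omega

/-- A cluster of one red point and several blue points, with no other point around, makes the red
point adjacent to all of these blue points. -/
theorem IsMinSpanningTree.card_le_maxVertexDegree_of_cluster (hd : 1 ≤ d) (hm : 0 < m)
    {z : ι ⊕ κ → EuclideanSpace ℝ (Fin d)} {T : SimpleGraph (ι ⊕ κ)}
    (hT : IsMinSpanningTree (completeBipartiteGraph ι κ)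
      (edgeLength (fun i => z (Sum.inl i)) fun j => z (Sum.inr j)) T)
    {c : EuclideanSpace ℝ (Fin d)} {i : ι} {S : Finset κ}
    (hz : z ∈ clusterEvent (closedCube c (1 / (16 * d * m))) (closedCube c (1 / (4 * m)))
      (Finset.disjSum {i} S)) :
    S.card ≤ maxVertexDegree T := by
  classical
  have hm' : (0 : ℝ) < m := by exact_mod_cast hm
  have hd' : (1 : ℝ) ≤ d := by exact_mod_cast hd
  obtain ⟨hin, hout⟩ := hz
  have hi : z (Sum.inl i) ∈ closedCube c (1 / (16 * d * m)) := hin _ (by simp)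
  have hadj : ∀ j ∈ S, T.Adj (Sum.inl i) (Sum.inr j) := by
    intro j hj
    have hj' : z (Sum.inr j) ∈ closedCube c (1 / (16 * d * m)) := hin _ (by simp [hj])
    refine hT.adj_of_nearest fun i' hi' => ?_
    have hi'' : z (Sum.inl i') ∉ closedCube c (1 / (4 * m)) := hout _ (by simp [hi'])
    simp only [closedCube, Set.mem_ofPred_eq, not_forall, not_le] at hi''
    obtain ⟨l, hl⟩ := hi''
    have h1 : dist (z (Sum.inr j)) (z (Sum.inl i)) ≤ d * (1 / (8 * d * m)) := by
      refine dist_le_of_forall_abs_sub_le (by positivity) fun l => ?_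
      have e : (1 : ℝ) / (8 * d * m) = 1 / (16 * d * m) + 1 / (16 * d * m) := by
        field_simp; norm_num
      rw [e]
      refine (abs_sub_le _ (c l) _).trans (add_le_add (hj' l) ?_)
      rw [abs_sub_comm]
      exact hi l
    have e1 : (d : ℝ) * (1 / (8 * d * m)) = 1 / (8 * m) := by field_simp
    have h2 := abs_sub_apply_le_dist (z (Sum.inr j)) (z (Sum.inl i')) l
    have h3 := abs_sub_le (z (Sum.inl i') l) (z (Sum.inr j) l) (c l)
    rw [abs_sub_comm (z (Sum.inl i') l) (z (Sum.inr j) l)] at h3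
    have h4 := hj' l
    have h5 : (1 : ℝ) / (16 * d * m) ≤ 1 / (16 * m) := by
      apply one_div_le_one_div_of_le (by positivity)
      nlinarith
    have e2 : (1 : ℝ) / (4 * m) = 1 / (16 * m) + 1 / (8 * m) + 1 / (16 * m) := by
      field_simp; norm_num
    have h6 : (0 : ℝ) < 1 / (16 * m) := by positivity
    linarith
  have := card_le_maxVertexDegree (s := S.map ⟨Sum.inr, Sum.inr_injective⟩) (Sum.inl i)
    (T := T) (by
      intro v hv
      obtain ⟨j, hj, rfl⟩ := Finset.mem_map.1 hv
      exact hadj j hj)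
  rwa [Finset.card_map] at this

end Deterministic

section Probability

variable {d m : ℕ} {ι κ : Type*} [Fintype ι] [Fintype κ]

/-- For independent uniform points, the probability of any event in terms of the points is bounded
by its product measure. No measurability is needed. -/
theorem measure_le_pi_cubeMeasure {Ω V : Type*} [MeasurableSpace Ω] {P : Measure Ω} [Fintype V]
    [IsProbabilityMeasure P] {Z : V → Ω → EuclideanSpace ℝ (Fin d)} (hind : iIndepFun Z P)
    (hunif : ∀ v, pdf.IsUniform (Z v) (unitCube d) P volume)
    (A : Set (V → EuclideanSpace ℝ (Fin d))) :
    P {ω | (fun v => Z v ω) ∈ A} ≤ (Measure.pi fun _ : V => cubeMeasure d) A := by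
  have hZ : ∀ v, AEMeasurable (Z v) P := fun v =>
    (hunif v).aemeasurable (by simp [volume_unitCube]) (by simp [volume_unitCube])
  have hmap : P.map (fun ω v => Z v ω) = Measure.pi fun _ : V => cubeMeasure d := by
    rw [hind.map_fun_eq_pi_map hZ]
    congr 1
    ext1 v
    exact hunif v
  rw [← hmap]
  exact Measure.le_map_apply (aemeasurable_pi_lambda _ hZ) A

theorem measureReal_exists_le {Ω J : Type*} [MeasurableSpace Ω] [Fintype J] (ν : Measure Ω)
    [IsProbabilityMeasure ν] {A : J → Set Ω} {p : ℝ} (h : ∀ j, ν.real (A j) ≤ p) :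
    ν.real {z | ∃ j, z ∈ A j} ≤ Fintype.card J * p := by
  have : {z | ∃ j, z ∈ A j} = ⋃ j ∈ (Finset.univ : Finset J), A j := by ext; simp
  rw [this]
  refine (measureReal_biUnion_finset_le _ _).trans ((Finset.sum_le_sum fun j _ => h j).trans ?_)
  simp

/-- Upper bound for the tail of the maximum degree, in terms of the number `m ^ d` of cells. -/
theorem measure_le_maxVertexDegree_le {Ω : Type*} [MeasurableSpace Ω] {P : Measure Ω}
    [IsProbabilityMeasure P] (hd : 1 ≤ d) (hm : 0 < m)
    {X : ι → Ω → EuclideanSpace ℝ (Fin d)} {Y : κ → Ω → EuclideanSpace ℝ (Fin d)}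
    (hind : iIndepFun (Sum.elim X Y) P)
    (hX : ∀ i, pdf.IsUniform (X i) (unitCube d) P volume)
    (hY : ∀ j, pdf.IsUniform (Y j) (unitCube d) P volume)
    {T : Ω → SimpleGraph (ι ⊕ κ)}
    (hT : ∀ᵐ ω ∂P, IsMinSpanningTree (completeBipartiteGraph ι κ)
      (edgeLength (fun i => X i ω) fun j => Y j ω) (T ω))
    {K : ℕ} (hK : Real.exp 2 * ((Fintype.card ι + Fintype.card κ) * (10 * d / m) ^ d) ≤ K) :
    P {ω | K ≤ maxVertexDegree (T ω)} ≤ ENNReal.ofReal (m ^ d *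
      (Real.exp (-(Fintype.card ι * (1 / m) ^ d)) + Real.exp (-(Fintype.card κ * (1 / m) ^ d)) +
        Real.exp (-K))) := by
  classical
  have hm' : (0 : ℝ) < m := by exact_mod_cast hm
  set ν := Measure.pi fun _ : ι ⊕ κ => cubeMeasure d with hν
  let cell : (Fin d → Fin m) → Set (EuclideanSpace ℝ (Fin d)) :=
    fun k => closedCube (cellCenter m k) (1 / (2 * m))
  let D : (Fin d → Fin m) → Set (EuclideanSpace ℝ (Fin d)) :=
    fun k => closedCube (cellCenter m k) (5 * d / m)
  let R : Finset (ι ⊕ κ) := Finset.univ.map ⟨Sum.inl, Sum.inl_injective⟩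
  let B : Finset (ι ⊕ κ) := Finset.univ.map ⟨Sum.inr, Sum.inr_injective⟩
  let bad1 : Set (ι ⊕ κ → EuclideanSpace ℝ (Fin d)) :=
    {z | ∃ k, z ∈ {z : ι ⊕ κ → EuclideanSpace ℝ (Fin d) | ∀ v ∈ R, z v ∉ cell k}}
  let bad2 : Set (ι ⊕ κ → EuclideanSpace ℝ (Fin d)) :=
    {z | ∃ k, z ∈ {z : ι ⊕ κ → EuclideanSpace ℝ (Fin d) | ∀ v ∈ B, z v ∉ cell k}}
  let bad3 : Set (ι ⊕ κ → EuclideanSpace ℝ (Fin d)) :=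
    {z | ∃ k, z ∈ {z : ι ⊕ κ → EuclideanSpace ℝ (Fin d) |
      ∃ S : Finset (ι ⊕ κ), S.card = K ∧ ∀ v ∈ S, z v ∈ D k}}
  let bad0 : Set (ι ⊕ κ → EuclideanSpace ℝ (Fin d)) := {z | ¬ ∀ v, z v ∈ unitCube d}
  have hcell : ∀ k, (cubeMeasure d).real (cell k) = (1 / m) ^ d := by
    intro k
    rw [cubeMeasure_real_closedCube (by positivity) (closedCube_cellCenter_subset k le_rfl)]
    congr 1
    field_simp
  have hcard : (Fintype.card (Fin d → Fin m) : ℝ) = m ^ d := by simp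
  have h0 : ν bad0 = 0 := by
    have : ∀ᵐ z ∂ν, ∀ v, z v ∈ unitCube d :=
      ae_all_iff.2 fun v => (Measure.tendsto_eval_ae_ae (i := v)).eventually (ae_mem_unitCube d)
    exact this
  have h1 : ν.real bad1 ≤ m ^ d * Real.exp (-(Fintype.card ι * (1 / m) ^ d)) := by
    rw [← hcard]
    refine measureReal_exists_le ν fun k => ?_
    refine (pi_real_forall_notMem_le (cubeMeasure d) R (measurableSet_closedCube _ _)).trans ?_
    rw [hcell k]
    simp [R]
  have h2 : ν.real bad2 ≤ m ^ d * Real.exp (-(Fintype.card κ * (1 / m) ^ d)) := by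
    rw [← hcard]
    refine measureReal_exists_le ν fun k => ?_
    refine (pi_real_forall_notMem_le (cubeMeasure d) B (measurableSet_closedCube _ _)).trans ?_
    rw [hcell k]
    simp [B]
  have h3 : ν.real bad3 ≤ m ^ d * Real.exp (-K) := by
    rw [← hcard]
    refine measureReal_exists_le ν fun k => pi_real_le_card_mem_le (cubeMeasure d) (D k) ?_
    refine le_trans ?_ hK
    rw [Fintype.card_sum]
    push_cast
    have := cubeMeasure_real_closedCube_le (cellCenter m k)
      (show (0 : ℝ) ≤ 5 * d / m by positivity)
    have e : (2 * (5 * d / m) : ℝ) = 10 * d / m := by ring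
    rw [e] at this
    gcongr
  have hsub : ∀ᵐ ω ∂P, ω ∈ {ω | K ≤ maxVertexDegree (T ω)} →
      ω ∈ {ω | (fun v => Sum.elim X Y v ω) ∈ bad0 ∪ (bad1 ∪ bad2 ∪ bad3)} := by
    filter_upwards [hT] with ω hω hdeg
    by_contra hcon
    simp only [Set.mem_union, not_or] at hcon
    obtain ⟨hc0, ⟨hc1, hc2⟩, hc3⟩ := hcon
    refine absurd hdeg (not_le.2 (IsMinSpanningTree.maxVertexDegree_lt hd hm
      (z := fun v => Sum.elim X Y v ω) hω (not_not.1 hc0) ?_ ?_ ?_))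
    · intro k
      by_contra hk
      push Not at hk
      refine hc1 ⟨k, fun v hv => ?_⟩
      obtain ⟨i, -, rfl⟩ := Finset.mem_map.1 hv
      exact hk i
    · intro k
      by_contra hk
      push Not at hk
      refine hc2 ⟨k, fun v hv => ?_⟩
      obtain ⟨i, -, rfl⟩ := Finset.mem_map.1 hv
      exact hk i
    · exact fun k hk => hc3 ⟨k, hk⟩
  have hunif : ∀ v, pdf.IsUniform (Sum.elim X Y v) (unitCube d) P volume := by
    rintro (i | j)
    exacts [hX i, hY j]
  calc P {ω | K ≤ maxVertexDegree (T ω)}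
      ≤ P {ω | (fun v => Sum.elim X Y v ω) ∈ bad0 ∪ (bad1 ∪ bad2 ∪ bad3)} := measure_mono_ae hsub
    _ ≤ ν (bad0 ∪ (bad1 ∪ bad2 ∪ bad3)) := measure_le_pi_cubeMeasure hind hunif _
    _ ≤ ν bad0 + ν (bad1 ∪ bad2 ∪ bad3) := measure_union_le _ _
    _ = ENNReal.ofReal (ν.real (bad1 ∪ bad2 ∪ bad3)) := by rw [h0, zero_add, ofReal_measureReal]
    _ ≤ _ := by
      refine ENNReal.ofReal_le_ofReal ?_
      have u1 := measureReal_union_le (μ := ν) (bad1 ∪ bad2) bad3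
      have u2 := measureReal_union_le (μ := ν) bad1 bad2
      linarith

/-- Bound for the probability that the maximum degree is less than `k`, in terms of the number
`m ^ d` of cells. -/
theorem measure_maxVertexDegree_lt_le {Ω : Type*} [MeasurableSpace Ω] {P : Measure Ω}
    [IsProbabilityMeasure P] (hd : 1 ≤ d) (hm : 0 < m)
    {X : ι → Ω → EuclideanSpace ℝ (Fin d)} {Y : κ → Ω → EuclideanSpace ℝ (Fin d)}
    (hind : iIndepFun (Sum.elim X Y) P)
    (hX : ∀ i, pdf.IsUniform (X i) (unitCube d) P volume)
    (hY : ∀ j, pdf.IsUniform (Y j) (unitCube d) P volume)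
    {T : Ω → SimpleGraph (ι ⊕ κ)}
    (hT : ∀ᵐ ω ∂P, IsMinSpanningTree (completeBipartiteGraph ι κ)
      (edgeLength (fun i => X i ω) fun j => Y j ω) (T ω))
    {k : ℕ} (hι : 0 < Fintype.card ι) (hk : k ≤ Fintype.card κ) :
    P {ω | maxVertexDegree (T ω) < k} ≤ ENNReal.ofReal
      (((m : ℝ) ^ d * (Fintype.card ι * (Fintype.card κ).choose k) *
        ((1 / (8 * d * m)) ^ d) ^ (k + 1) *
        (1 - (1 / (2 * m)) ^ d) ^ (Fintype.card ι + Fintype.card κ - (k + 1)))⁻¹ +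
      (((1 - (1 / (2 * m : ℝ)) ^ d) ^ (2 * (k + 1)))⁻¹ - 1)) := by
  classical
  have hm' : (0 : ℝ) < m := by exact_mod_cast hm
  have hm1 : (1 : ℝ) ≤ m := by exact_mod_cast hm
  have hd' : (1 : ℝ) ≤ d := by exact_mod_cast hd
  set ν := Measure.pi fun _ : ι ⊕ κ => cubeMeasure d with hν
  let I := ι × {S : Finset κ // S ∈ Finset.univ.powersetCard k}
  let W : I → Finset (ι ⊕ κ) := fun t => Finset.disjSum {t.1} t.2.1
  let A : (Fin d → Fin m) → Set (EuclideanSpace ℝ (Fin d)) :=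
    fun l => closedCube (cellCenter m l) (1 / (16 * d * m))
  let B : (Fin d → Fin m) → Set (EuclideanSpace ℝ (Fin d)) :=
    fun l => closedCube (cellCenter m l) (1 / (4 * m))
  have hr1 : (1 : ℝ) / (16 * d * m) ≤ 1 / (4 * m) := by
    apply one_div_le_one_div_of_le (by positivity)
    nlinarith
  have hr2 : (1 : ℝ) / (4 * m) ≤ 1 / (2 * m) := by
    apply one_div_le_one_div_of_le (by positivity)
    linarith
  have hA : ∀ l, (cubeMeasure d).real (A l) = (1 / (8 * d * m)) ^ d := by
    intro l
    rw [cubeMeasure_real_closedCube (by positivity)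
      (closedCube_cellCenter_subset l (hr1.trans hr2))]
    congr 1
    field_simp
    norm_num
  have hB : ∀ l, (cubeMeasure d).real (B l) = (1 / (2 * m)) ^ d := by
    intro l
    rw [cubeMeasure_real_closedCube (by positivity) (closedCube_cellCenter_subset l hr2)]
    congr 1
    field_simp
    norm_num
  have hAB : ∀ l, A l ⊆ B l := fun l x hx i => (hx i).trans hr1
  have hβ1 : ((1 : ℝ) / (2 * m)) ^ d < 1 := by
    refine pow_lt_one₀ (by positivity) ?_ (by omega)
    rw [div_lt_one (by positivity)]
    linarith
  have hW : Function.Injective W := by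
    rintro ⟨i, S, hS⟩ ⟨i', S', hS'⟩ h
    obtain ⟨h1, h2⟩ := Finset.disjSum_inj.1 h
    simp only [Finset.singleton_inj] at h1
    subst h1
    simp only at h2
    subst h2
    rfl
  have hWc : ∀ t, (W t).card = k + 1 := by
    rintro ⟨i, S, hS⟩
    have := (Finset.mem_powersetCard.1 hS).2
    simp [W, this, add_comm]
  have : Nonempty ι := Fintype.card_pos_iff.1 hι
  have : Nonempty {S : Finset κ // S ∈ Finset.univ.powersetCard k} := by
    obtain ⟨S, hS⟩ := Finset.powersetCard_nonempty.2 (show k ≤ (Finset.univ : Finset κ).card from hk)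
    exact ⟨⟨S, hS⟩⟩
  have : Nonempty (Fin d → Fin m) := ⟨fun _ => ⟨0, hm⟩⟩
  have hmain := pi_real_forall_notMem_clusterEvent_le (cubeMeasure d) (A := A) (B := B)
    (fun l => measurableSet_closedCube _ _) (fun l => measurableSet_closedCube _ _) hAB
    (fun l l' hl => disjoint_closedCube_cellCenter hl) hA hB (by positivity) hβ1 hW hWc
  have hcI : Fintype.card I = Fintype.card ι * (Fintype.card κ).choose k := by
    simp only [I, Fintype.card_prod, Fintype.card_coe, Finset.card_powersetCard, Finset.card_univ]
  rw [hcI, Fintype.card_sum, Fintype.card_fun, Fintype.card_fin, Fintype.card_fin] at hmain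
  push_cast at hmain
  rw [← mul_assoc ((m : ℝ) ^ d * _)] at hmain
  have hunif : ∀ v, pdf.IsUniform (Sum.elim X Y v) (unitCube d) P volume := by
    rintro (i | j)
    exacts [hX i, hY j]
  have hsub : ∀ᵐ ω ∂P, ω ∈ {ω | maxVertexDegree (T ω) < k} →
      ω ∈ {ω | (fun v => Sum.elim X Y v ω) ∈
        {z | ∀ (l : Fin d → Fin m) (t : I), z ∉ clusterEvent (A l) (B l) (W t)}} := by
    filter_upwards [hT] with ω hω hdeg l t hmem
    have := IsMinSpanningTree.card_le_maxVertexDegree_of_cluster hd hm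
      (z := fun v => Sum.elim X Y v ω) hω hmem
    rw [(Finset.mem_powersetCard.1 t.2.2).2] at this
    exact absurd hdeg (not_lt.2 this)
  refine (measure_mono_ae hsub).trans ((measure_le_pi_cubeMeasure hind hunif
    {z | ∀ (l : Fin d → Fin m) (t : I), z ∉ clusterEvent (A l) (B l) (W t)}).trans ?_)
  rw [← ofReal_measureReal]
  exact ENNReal.ofReal_le_ofReal hmain

end Probability

/-! ### Choice of the scale and asymptotics -/

theorem exists_nat_pow_le_le {d : ℕ} (hd : 1 ≤ d) {x : ℝ} (hx : 1 ≤ x) :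
    ∃ m : ℕ, 0 < m ∧ (m : ℝ) ^ d ≤ x ∧ x ≤ 2 ^ d * (m : ℝ) ^ d := by
  have hd0 : d ≠ 0 := by omega
  have hx0 : 0 ≤ x := by linarith
  set y := x ^ ((d : ℝ)⁻¹) with hy
  have hyd : y ^ d = x := Real.rpow_inv_natCast_pow hx0 hd0
  have hy1 : 1 ≤ y := Real.one_le_rpow hx (by positivity)
  have hm1 : 1 ≤ ⌊y⌋₊ := (Nat.one_le_floor_iff y).2 hy1
  refine ⟨⌊y⌋₊, hm1, ?_, ?_⟩
  · rw [← hyd]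
    exact pow_le_pow_left₀ (by positivity) (Nat.floor_le (by linarith)) d
  · rw [← mul_pow, ← hyd]
    refine pow_le_pow_left₀ (by linarith) ?_ d
    have h1 : (1 : ℝ) ≤ (⌊y⌋₊ : ℝ) := by exact_mod_cast hm1
    have h2 := Nat.lt_floor_add_one y
    linarith

theorem pow_le_pow_mul_choose {n k : ℕ} (hk : k ≤ n) : n ^ k ≤ k ^ k * n.choose k := by
  have h : n ^ k * k.factorial ≤ k ^ k * n.descFactorial k := by
    rw [← Nat.descFactorial_self k, Nat.descFactorial_eq_prod_range,
      Nat.descFactorial_eq_prod_range]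
    have e : ∀ a : ℕ, a ^ k = ∏ _i ∈ Finset.range k, a := fun a => by simp
    rw [e n, e k, ← Finset.prod_mul_distrib, ← Finset.prod_mul_distrib]
    refine Finset.prod_le_prod' fun i hi => ?_
    have hik : i ≤ k := (Finset.mem_range.1 hi).le
    obtain ⟨r, rfl⟩ := Nat.exists_eq_add_of_le hk
    obtain ⟨t, rfl⟩ := Nat.exists_eq_add_of_le hik
    have e1 : i + t + r - i = t + r := by omega
    have e2 : i + t - i = t := by omega
    rw [e1, e2]
    nlinarith [Nat.zero_le (i * r)]
  rw [Nat.descFactorial_eq_factorial_mul_choose] at h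
  refine Nat.le_of_mul_le_mul_right (c := k.factorial) ?_ k.factorial_pos
  calc n ^ k * k.factorial ≤ k ^ k * (k.factorial * n.choose k) := h
    _ = _ := by ring

/-- A binomial variable has at least one expected `k`-subset of successes as long as `k` does not
exceed its mean. -/
theorem one_le_choose_mul_pow {n k : ℕ} (hk0 : 0 < k) (hk : k ≤ n) {q : ℝ} (hq : 0 ≤ q)
    (hkq : (k : ℝ) ≤ n * q) : 1 ≤ (n.choose k : ℝ) * q ^ k := by
  have h : (n : ℝ) ^ k ≤ k ^ k * n.choose k := by exact_mod_cast pow_le_pow_mul_choose hk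
  have hk' : (0 : ℝ) < (k : ℝ) ^ k := by positivity
  have : (k : ℝ) ^ k * 1 ≤ k ^ k * (n.choose k * q ^ k) := by
    calc (k : ℝ) ^ k * 1 ≤ (n * q) ^ k := by
          rw [mul_one]; exact pow_le_pow_left₀ (by positivity) hkq k
      _ = n ^ k * q ^ k := mul_pow _ _ _
      _ ≤ (k ^ k * n.choose k) * q ^ k := by gcongr
      _ = _ := by ring
  exact le_of_mul_le_mul_left this hk'

theorem exp_neg_two_mul_le_one_sub {x : ℝ} (hx0 : 0 ≤ x) (hx : x ≤ 1 / 2) :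
    Real.exp (-(2 * x)) ≤ 1 - x := by
  have h := Real.add_one_le_exp (2 * x)
  rw [Real.exp_neg, inv_le_comm₀ (Real.exp_pos _) (by linarith)]
  refine le_trans ?_ h
  rw [inv_le_iff_one_le_mul₀ (by linarith)]
  nlinarith

theorem tendsto_log_natCast : Tendsto (fun n : ℕ => Real.log n) atTop atTop :=
  Real.tendsto_log_atTop.comp tendsto_natCast_atTop_atTop

theorem eventually_mul_log_le (κ : ℝ) : ∀ᶠ n : ℕ in atTop, κ * Real.log n ≤ n := by
  have h := (Real.isLittleO_log_id_atTop.comp_tendsto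
    (tendsto_natCast_atTop_atTop (R := ℝ))).bound (show (0 : ℝ) < (|κ| + 1)⁻¹ by positivity)
  filter_upwards [h] with n hn
  simp only [Function.comp, id, Real.norm_eq_abs, Nat.abs_cast] at hn
  have h1 : (|κ| + 1) * |Real.log n| ≤ n := by
    rw [inv_mul_eq_div, le_div_iff₀ (by positivity)] at hn
    linarith
  calc κ * Real.log n ≤ |κ * Real.log n| := le_abs_self _
    _ = |κ| * |Real.log n| := abs_mul _ _
    _ ≤ (|κ| + 1) * |Real.log n| := by gcongr; linarith
    _ ≤ n := h1

/-- The error term of the lower bound, as a function of `L = log n`, vanishes. -/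
theorem tendsto_lowerError (C : ℝ) :
    Tendsto (fun L : ℝ => C * (L * Real.exp (-(L / 2))) + ((1 - L ^ 2 * Real.exp (-L))⁻¹ - 1))
      atTop (𝓝 0) := by
  have h1 : Tendsto (fun L : ℝ => L * Real.exp (-(L / 2))) atTop (𝓝 0) := by
    have h := ((Real.tendsto_pow_mul_exp_neg_atTop_nhds_zero 1).comp
      (tendsto_id.atTop_div_const (show (0 : ℝ) < 2 by norm_num))).const_mul 2
    rw [mul_zero] at h
    refine h.congr fun L => ?_
    simp only [Function.comp, id, pow_one]
    ring
  have h2 := (((Real.tendsto_pow_mul_exp_neg_atTop_nhds_zero 2).const_sub 1).inv₀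
    (by norm_num)).sub_const 1
  have h3 := (h1.const_mul C).add h2
  simpa using h3

namespace RandomBipartiteMST

variable {d : ℕ} {αR : ℝ}

theorem eventually_le_nR (M : RandomBipartiteMST d αR) {β : ℝ} (hβ : β < αR) :
    ∀ᶠ n : ℕ in atTop, β * n ≤ M.nR n := by
  filter_upwards [M.tendsto_ratio.eventually_const_lt hβ, eventually_gt_atTop 0] with n hn h0
  have : (0 : ℝ) < n := by exact_mod_cast h0
  exact ((lt_div_iff₀ this).1 hn).le

theorem eventually_le_nB (M : RandomBipartiteMST d αR) {β : ℝ} (hβ : β < 1 - αR) :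
    ∀ᶠ n : ℕ in atTop, β * n ≤ M.nB n := by
  filter_upwards [M.tendsto_ratio.eventually_lt_const (show αR < 1 - β by linarith),
    eventually_gt_atTop 0] with n hn h0
  have h0' : (0 : ℝ) < n := by exact_mod_cast h0
  have h1 := ((div_lt_iff₀ h0').1 hn).le
  have h2 : (M.nR n : ℝ) + M.nB n = n := by exact_mod_cast M.card_add n
  linarith

/-- The maximum degree exceeds a large multiple of `log n` with polynomially small probability. -/
theorem exists_measure_mul_log_lt_le (hd : 1 ≤ d) (hα0 : 0 < αR) (hα1 : αR < 1) {a : ℝ}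
    (ha : 0 < a) : ∃ A : ℝ, 0 < A ∧ ∀ M : RandomBipartiteMST d αR,
      ∀ᶠ n : ℕ in atTop, M.P n {ω | A * Real.log n < (M.Δ n ω : ℝ)} ≤
        ENNReal.ofReal (3 * (n : ℝ) ^ (-a)) := by
  set β := min αR (1 - αR) / 2 with hβ
  have hmin : 0 < min αR (1 - αR) := lt_min hα0 (by linarith)
  have hβ0 : 0 < β := by positivity
  have hβR : β < αR := by linarith [min_le_left αR (1 - αR)]
  have hβB : β < 1 - αR := by linarith [min_le_right αR (1 - αR)]
  have hd' : (1 : ℝ) ≤ d := by exact_mod_cast hd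
  -- With about `n / (κ log n)` cells, a cell is missed by a colour with probability at most
  -- `n ^ (-(a + 1))`.
  set κ := (a + 1) / β with hκ
  have hκ0 : 0 < κ := by positivity
  set D := Real.exp 2 * ((10 * d) ^ d * (2 ^ d * κ)) with hD
  set A := max D (a + 1) with hA
  have hA0 : 0 < A := lt_of_lt_of_le (by linarith) (le_max_right _ _)
  refine ⟨A, hA0, fun M => ?_⟩
  filter_upwards [M.eventually_le_nR hβR, M.eventually_le_nB hβB, eventually_mul_log_le κ,
    tendsto_log_natCast.eventually_ge_atTop (1 / κ), eventually_gt_atTop 0] with n hR hB hκn hL hn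
  have hn' : (0 : ℝ) < n := by exact_mod_cast hn
  set L := Real.log n with hLdef
  have hL1 : 1 ≤ κ * L := by rw [div_le_iff₀ hκ0] at hL; linarith
  have hL0 : 0 < L := lt_of_lt_of_le (by positivity) hL
  obtain ⟨m, hm, hm1, hm2⟩ := exists_nat_pow_le_le hd
    (show 1 ≤ n / (κ * L) by rw [le_div_iff₀ (by positivity)]; linarith)
  have hm' : (0 : ℝ) < m := by exact_mod_cast hm
  have hw1 : κ * L / n ≤ (1 / m : ℝ) ^ d := by
    rw [one_div_pow, ← one_div_div]
    exact one_div_le_one_div_of_le (by positivity) hm1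
  have hw2 : n * (1 / m : ℝ) ^ d ≤ 2 ^ d * κ * L := by
    rw [one_div_pow, mul_one_div, div_le_iff₀ (by positivity)]
    rw [div_le_iff₀ (by positivity)] at hm2
    linarith
  have hmn : (m : ℝ) ^ d ≤ n := hm1.trans (div_le_self hn'.le hL1)
  have hnR : 0 < M.nR n := by
    have : (0 : ℝ) < M.nR n := lt_of_lt_of_le (by positivity) hR
    exact_mod_cast this
  have hnB : 0 < M.nB n := by
    have : (0 : ℝ) < M.nB n := lt_of_lt_of_le (by positivity) hB
    exact_mod_cast this
  have hsum : (M.nR n : ℝ) + M.nB n = n := by exact_mod_cast M.card_add n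
  set K := ⌊A * L⌋₊ + 1 with hK
  have hKA : A * L ≤ K := by
    rw [hK]; push_cast; exact (Nat.lt_floor_add_one _).le
  have hset : {ω | A * L < (M.Δ n ω : ℝ)} = {ω | K ≤ maxVertexDegree (M.T n ω)} := by
    ext ω
    simp only [Set.mem_ofPred_eq, RandomBipartiteMST.Δ]
    rw [← Nat.floor_lt (by positivity), hK, Nat.succ_le_iff]
  have hcrowd : Real.exp 2 * ((Fintype.card (Fin (M.nR n)) + Fintype.card (Fin (M.nB n))) *
      (10 * d / m : ℝ) ^ d) ≤ K := by
    rw [Fintype.card_fin, Fintype.card_fin, hsum]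
    refine le_trans ?_ hKA
    have e : (10 * d / m : ℝ) ^ d = (10 * d) ^ d * (1 / m) ^ d := by
      rw [← mul_pow]; ring_nf
    calc Real.exp 2 * (n * (10 * d / m : ℝ) ^ d)
        = Real.exp 2 * ((10 * d) ^ d * (n * (1 / m : ℝ) ^ d)) := by rw [e]; ring
      _ ≤ Real.exp 2 * ((10 * d) ^ d * (2 ^ d * κ * L)) := by gcongr
      _ = D * L := by rw [hD]; ring
      _ ≤ A * L := by gcongr; exact le_max_left _ _
  rw [hset]
  refine (measure_le_maxVertexDegree_le hd hm (M.indep n) (M.unif_X n) (M.unif_Y n)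
    (M.isMST n hnR hnB) hcrowd).trans (ENNReal.ofReal_le_ofReal ?_)
  rw [Fintype.card_fin, Fintype.card_fin]
  have hexp : Real.exp (-((a + 1) * L)) = (n : ℝ) ^ (-(a + 1)) := by
    rw [Real.rpow_def_of_pos hn', ← hLdef]; ring_nf
  have hcol : ∀ N : ℕ, β * n ≤ N →
      Real.exp (-(N * (1 / m : ℝ) ^ d)) ≤ (n : ℝ) ^ (-(a + 1)) := by
    intro N hN
    rw [← hexp]
    refine Real.exp_le_exp.2 (neg_le_neg ?_)
    calc (a + 1) * L = β * n * (κ * L / n) := by rw [hκ]; field_simp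
      _ ≤ N * (1 / m : ℝ) ^ d := by gcongr
  have hKe : Real.exp (-(K : ℝ)) ≤ (n : ℝ) ^ (-(a + 1)) := by
    rw [← hexp]
    refine Real.exp_le_exp.2 (neg_le_neg (le_trans ?_ hKA))
    gcongr
    exact le_max_right _ _
  calc (m : ℝ) ^ d * (Real.exp (-(M.nR n * (1 / m : ℝ) ^ d)) +
        Real.exp (-(M.nB n * (1 / m : ℝ) ^ d)) + Real.exp (-K))
      ≤ n * ((n : ℝ) ^ (-(a + 1)) + (n : ℝ) ^ (-(a + 1)) + (n : ℝ) ^ (-(a + 1))) := by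
        gcongr
        exacts [hcol _ hR, hcol _ hB]
    _ = 3 * (n * (n : ℝ) ^ (-(a + 1))) := by ring
    _ = 3 * (n : ℝ) ^ (-a) := by
        rw [← Real.rpow_one_add' hn'.le (by linarith)]
        ring_nf

/-- The maximum degree is at least a small multiple of `log n` with high probability. -/
theorem exists_tendsto_measure_lt_mul_log (hd : 1 ≤ d) (hα0 : 0 < αR) (hα1 : αR < 1) :
    ∃ c : ℝ, 0 < c ∧ ∀ M : RandomBipartiteMST d αR,
      Tendsto (fun n : ℕ => M.P n {ω | (M.Δ n ω : ℝ) < c * Real.log n}) atTop (𝓝 0) := by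
  set β := min αR (1 - αR) / 2 with hβ
  have hmin : 0 < min αR (1 - αR) := lt_min hα0 (by linarith)
  have hβ0 : 0 < β := by positivity
  have hβR : β < αR := by linarith [min_le_left αR (1 - αR)]
  have hβB : β < 1 - αR := by linarith [min_le_right αR (1 - αR)]
  have hd' : (1 : ℝ) ≤ d := by exact_mod_cast hd
  set c := β * (1 / (8 * d)) ^ d / 4 with hc
  have hc0 : 0 < c := by positivity
  refine ⟨c / 2, by positivity, fun M => ?_⟩
  have herr : Tendsto (fun n : ℕ => ENNReal.ofReal (2 ^ d / 4 * (Real.log n *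
      Real.exp (-(Real.log n / 2))) + ((1 - Real.log n ^ 2 * Real.exp (-Real.log n))⁻¹ - 1)))
      atTop (𝓝 0) := by
    have := ENNReal.tendsto_ofReal ((tendsto_lowerError (2 ^ d / 4)).comp tendsto_log_natCast)
    rwa [ENNReal.ofReal_zero] at this
  refine tendsto_of_tendsto_of_tendsto_of_le_of_le' tendsto_const_nhds herr
    (Eventually.of_forall fun _ => zero_le) ?_
  have hsmall : ∀ᶠ n : ℕ in atTop, Real.log n ^ 2 * Real.exp (-Real.log n) < 1 :=
    ((Real.tendsto_pow_mul_exp_neg_atTop_nhds_zero 2).comp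
      tendsto_log_natCast).eventually_lt_const (by norm_num)
  filter_upwards [M.eventually_le_nR hβR, M.eventually_le_nB hβB, eventually_mul_log_le 1,
    tendsto_log_natCast.eventually_ge_atTop 1, tendsto_log_natCast.eventually_ge_atTop (2 / c),
    eventually_gt_atTop 0, hsmall] with n hR hB hLn hL1 hLc hn hsm
  have hn' : (0 : ℝ) < n := by exact_mod_cast hn
  set L := Real.log n with hLdef
  have hexpL : Real.exp L = n := Real.exp_log hn'
  have hL0 : 0 < L := by linarith
  rw [one_mul] at hLn
  -- With about `4 n / log n` cells, the outer cube of a cell stays free of all other points with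
  -- probability at least `n ^ (-1/2)`, while the expected number of points in the inner cube is of
  -- order `log n`.
  obtain ⟨m, hm, hm1, hm2⟩ := exists_nat_pow_le_le hd
    (show 1 ≤ 4 * n / L by rw [le_div_iff₀ (by positivity)]; linarith)
  have hm' : (0 : ℝ) < m := by exact_mod_cast hm
  have hw1 : L / (4 * n) ≤ (1 / m : ℝ) ^ d := by
    rw [one_div_pow, ← one_div_div]
    exact one_div_le_one_div_of_le (by positivity) hm1
  have hw2 : n * (1 / m : ℝ) ^ d ≤ 2 ^ d * L / 4 := by
    rw [one_div_pow, mul_one_div, div_le_iff₀ (by positivity)]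
    rw [div_le_iff₀ (by positivity)] at hm2
    linarith
  have hnR : 0 < M.nR n := by
    have : (0 : ℝ) < M.nR n := lt_of_lt_of_le (by positivity) hR
    exact_mod_cast this
  have hnB : 0 < M.nB n := by
    have : (0 : ℝ) < M.nB n := lt_of_lt_of_le (by positivity) hB
    exact_mod_cast this
  have hBn : (M.nB n : ℝ) ≤ n := by
    have := M.card_add n
    exact_mod_cast (show M.nB n ≤ n by omega)
  -- `q` and `b` are the volumes of the inner and the outer cube of a cell.
  set q : ℝ := (1 / (8 * d * m)) ^ d with hq
  set b : ℝ := (1 / (2 * m)) ^ d with hb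
  have hq0 : 0 < q := by positivity
  have hb0 : 0 < b := by positivity
  have hqe : q = (1 / (8 * d)) ^ d * (1 / m : ℝ) ^ d := by
    rw [hq, ← mul_pow]; congr 1; field_simp
  have hbe : b = (1 / 2) ^ d * (1 / m : ℝ) ^ d := by
    rw [hb, ← mul_pow]; congr 1; field_simp
  have hbn : n * b ≤ L / 4 := by
    calc n * b = (1 / 2) ^ d * (n * (1 / m : ℝ) ^ d) := by rw [hbe]; ring
      _ ≤ (1 / 2) ^ d * (2 ^ d * L / 4) := by gcongr
      _ = ((1 / 2) * 2) ^ d * L / 4 := by rw [mul_pow]; ring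
      _ = L / 4 := by norm_num
  have hqb : q ≤ b := by
    rw [hq, hb]
    refine pow_le_pow_left₀ (by positivity) ?_ d
    apply one_div_le_one_div_of_le (by positivity)
    nlinarith
  have hqL : ∀ N : ℕ, β * n ≤ N → c * L ≤ N * q := by
    intro N hN
    calc c * L = β * n * ((1 / (8 * d)) ^ d * (L / (4 * n))) := by rw [hc]; field_simp
      _ ≤ N * ((1 / (8 * d)) ^ d * (1 / m : ℝ) ^ d) := by gcongr
      _ = N * q := by rw [hqe]
  have hcL : 2 ≤ c * L := by rw [div_le_iff₀ hc0] at hLc; linarith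
  have hb1 : b ≤ 1 / 4 := by
    have : n * b ≤ n * (1 / 4) := by linarith
    exact le_of_mul_le_mul_left this hn'
  set k := ⌊M.nB n * q⌋₊ with hk
  have hkle : (k : ℝ) ≤ M.nB n * q := Nat.floor_le (by positivity)
  have hkge : c / 2 * L ≤ k := by
    have h1 := Nat.lt_floor_add_one (M.nB n * q)
    have h2 := hqL _ hB
    linarith
  have hk0 : 0 < k := by
    have : (0 : ℝ) < k := lt_of_lt_of_le (by positivity) hkge
    exact_mod_cast this
  have hkL : (k : ℝ) ≤ L / 4 := by
    refine hkle.trans (le_trans ?_ hbn)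
    gcongr
  have hkB : k ≤ M.nB n := by
    have : (k : ℝ) ≤ M.nB n := hkle.trans (mul_le_of_le_one_right (by positivity) (by linarith))
    exact_mod_cast this
  have hsub : {ω | (M.Δ n ω : ℝ) < c / 2 * L} ⊆ {ω | maxVertexDegree (M.T n ω) < k} := by
    intro ω hω
    have : (M.Δ n ω : ℝ) < k := lt_of_lt_of_le hω hkge
    exact_mod_cast this
  refine (measure_mono hsub).trans ((measure_maxVertexDegree_lt_le hd hm (M.indep n) (M.unif_X n)
    (M.unif_Y n) (M.isMST n hnR hnB) (by simpa using hnR) (by simpa using hkB)).trans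
    (ENNReal.ofReal_le_ofReal ?_))
  rw [Fintype.card_fin, Fintype.card_fin, M.card_add n, ← hq, ← hb]
  have hb1' : 0 < 1 - b := by linarith
  have hempty : Real.exp (-(L / 2)) ≤ (1 - b) ^ (n - (k + 1)) := by
    calc Real.exp (-(L / 2)) ≤ Real.exp (-(2 * b)) ^ n := by
          rw [← Real.exp_nat_mul]
          exact Real.exp_le_exp.2 (by linarith)
      _ ≤ (1 - b) ^ n :=
          pow_le_pow_left₀ (Real.exp_pos _).le (exp_neg_two_mul_le_one_sub hb0.le (by linarith)) n
      _ ≤ (1 - b) ^ (n - (k + 1)) :=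
          pow_le_pow_of_le_one hb1'.le (by linarith) (Nat.sub_le _ _)
  have hmain : 4 / 2 ^ d * (Real.exp (L / 2) / L) ≤
      (m : ℝ) ^ d * (M.nR n * (M.nB n).choose k) * q ^ (k + 1) * (1 - b) ^ (n - (k + 1)) := by
    have hcell : 4 * n / L / 2 ^ d ≤ (m : ℝ) ^ d := by
      rw [div_le_iff₀ (by positivity)]; linarith
    have hred : 1 ≤ M.nR n * q := by linarith [hqL _ hR]
    have hblue := one_le_choose_mul_pow hk0 hkB hq0.le hkle
    calc 4 / 2 ^ d * (Real.exp (L / 2) / L)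
        = 4 * Real.exp L / L / 2 ^ d * (1 * 1) * Real.exp (-(L / 2)) := by
          have : Real.exp (L / 2) = Real.exp L * Real.exp (-(L / 2)) := by
            rw [← Real.exp_add]; ring_nf
          rw [this]; ring
      _ ≤ (m : ℝ) ^ d * ((M.nR n * q) * ((M.nB n).choose k * q ^ k)) *
            (1 - b) ^ (n - (k + 1)) := by
          rw [hexpL]
          gcongr
      _ = _ := by ring
  have hpair : 1 - L ^ 2 * Real.exp (-L) ≤ (1 - b) ^ (2 * (k + 1)) := by
    have h1 := one_add_mul_le_pow (show (-2 : ℝ) ≤ -b by linarith) (2 * (k + 1))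
    rw [← sub_eq_add_neg] at h1
    refine le_trans ?_ h1
    have h2 : b ≤ L / 4 * Real.exp (-L) := by
      rw [Real.exp_neg, hexpL, ← div_eq_mul_inv, le_div_iff₀ hn']; linarith
    have h3 : (2 * (k + 1) : ℝ) ≤ 4 * L := by linarith
    push_cast
    have h4 : (2 * (k + 1) : ℝ) * b ≤ 4 * L * (L / 4 * Real.exp (-L)) := by gcongr
    linarith
  refine add_le_add ?_ (sub_le_sub_right (inv_anti₀ (by linarith) hpair) 1)
  refine (inv_anti₀ (by positivity) hmain).trans (le_of_eq ?_)
  rw [Real.exp_neg]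
  field_simp

/-- Moments of the maximum degree, from its tail and the trivial bound `Δ ≤ n`. -/
theorem lintegral_rpow_le (M : RandomBipartiteMST d αR) {n : ℕ} {A B q : ℝ} (hA : 0 ≤ A)
    (hB : 0 ≤ B) (hq : 0 < q) (hn : 1 ≤ Real.log n)
    (h : M.P n {ω | A * Real.log n < (M.Δ n ω : ℝ)} ≤ ENNReal.ofReal (B * (n : ℝ) ^ (-q))) :
    ∫⁻ ω, ENNReal.ofReal ((M.Δ n ω : ℝ) ^ q) ∂(M.P n) ≤
      ENNReal.ofReal ((A ^ q + B) * Real.log n ^ q) := by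
  have hn0 : (0 : ℝ) < n := by
    rcases Nat.eq_zero_or_pos n with rfl | h'
    · norm_num at hn
    · exact_mod_cast h'
  set L := Real.log n with hL
  have hL0 : 0 ≤ L := by linarith
  have hΔ : ∀ ω, (M.Δ n ω : ℝ) ≤ n := by
    intro ω
    have := maxVertexDegree_le_card (M.T n ω)
    rw [Fintype.card_sum, Fintype.card_fin, Fintype.card_fin, M.card_add] at this
    exact_mod_cast this
  set S := {ω | A * L < (M.Δ n ω : ℝ)} with hS
  have hpt : ∀ ω, ENNReal.ofReal ((M.Δ n ω : ℝ) ^ q) ≤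
      ENNReal.ofReal ((A * L) ^ q) + S.indicator (fun _ => ENNReal.ofReal ((n : ℝ) ^ q)) ω := by
    intro ω
    by_cases hω : ω ∈ S
    · rw [Set.indicator_of_mem hω]
      refine le_add_left (ENNReal.ofReal_le_ofReal ?_)
      exact Real.rpow_le_rpow (by positivity) (hΔ ω) hq.le
    · rw [Set.indicator_of_notMem hω, add_zero]
      refine ENNReal.ofReal_le_ofReal (Real.rpow_le_rpow (by positivity) ?_ hq.le)
      exact not_lt.1 hω
  calc ∫⁻ ω, ENNReal.ofReal ((M.Δ n ω : ℝ) ^ q) ∂(M.P n)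
      ≤ ∫⁻ ω, (ENNReal.ofReal ((A * L) ^ q) +
          S.indicator (fun _ => ENNReal.ofReal ((n : ℝ) ^ q)) ω) ∂(M.P n) := lintegral_mono hpt
    _ = ENNReal.ofReal ((A * L) ^ q) +
          ∫⁻ ω, S.indicator (fun _ => ENNReal.ofReal ((n : ℝ) ^ q)) ω ∂(M.P n) := by
        rw [lintegral_add_left measurable_const, lintegral_const, measure_univ, mul_one]
    _ ≤ ENNReal.ofReal ((A * L) ^ q) +
          ENNReal.ofReal ((n : ℝ) ^ q) * ENNReal.ofReal (B * (n : ℝ) ^ (-q)) := by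
        gcongr
        exact (lintegral_indicator_const_le _ _).trans (by gcongr)
    _ = ENNReal.ofReal (A ^ q * L ^ q + B) := by
        rw [← ENNReal.ofReal_mul (by positivity), ← ENNReal.ofReal_add (by positivity)
          (by positivity), Real.mul_rpow hA hL0, Real.rpow_neg hn0.le]
        congr 2
        have : (n : ℝ) ^ q ≠ 0 := (Real.rpow_pos_of_pos hn0 q).ne'
        field_simp
    _ ≤ ENNReal.ofReal ((A ^ q + B) * L ^ q) := by
        refine ENNReal.ofReal_le_ofReal ?_
        have : 1 ≤ L ^ q := Real.one_le_rpow hn hq.le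
        nlinarith

end RandomBipartiteMST

theorem theorem1 (d : ℕ) (hd : 1 ≤ d) (αR : ℝ) (hα0 : 0 < αR) (hα1 : αR < 1) :
    (∃ C : ℝ, 0 < C ∧ ∀ M : RandomBipartiteMST d αR,
      Tendsto (fun n : ℕ => M.P n {ω | C⁻¹ < (M.Δ n ω : ℝ) / Real.log n ∧
        (M.Δ n ω : ℝ) / Real.log n < C}) atTop (𝓝 1)) ∧
    (∀ a : ℝ, 0 < a → ∃ C : ℝ, 0 < C ∧ ∀ M : RandomBipartiteMST d αR,
      ∀ᶠ n : ℕ in atTop, M.P n {ω | C * Real.log n < (M.Δ n ω : ℝ)} ≤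
        ENNReal.ofReal (C * (n : ℝ) ^ (-a))) ∧
    (∀ q : ℝ, 0 < q → ∃ C : ℝ, 0 < C ∧ ∀ M : RandomBipartiteMST d αR,
      ∀ᶠ n : ℕ in atTop, ∫⁻ ω, ENNReal.ofReal ((M.Δ n ω : ℝ) ^ q) ∂(M.P n) ≤
        ENNReal.ofReal (C * Real.log n ^ q)) := by
  refine ⟨?_, fun a ha => ?_, fun q hq => ?_⟩
  · obtain ⟨A, hA0, hA⟩ :=
      RandomBipartiteMST.exists_measure_mul_log_lt_le hd hα0 hα1 (zero_lt_one (α := ℝ))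
    obtain ⟨c, hc0, hc⟩ := RandomBipartiteMST.exists_tendsto_measure_lt_mul_log hd hα0 hα1
    refine ⟨A + c⁻¹ + 1, by positivity, fun M => ?_⟩
    have hC1 : (A + c⁻¹ + 1)⁻¹ < c := by
      rw [inv_lt_comm₀ (by positivity) hc0]; linarith
    have hC2 : A < A + c⁻¹ + 1 := by
      have : 0 < c⁻¹ := by positivity
      linarith
    have hup : Tendsto (fun n : ℕ => M.P n {ω | A * Real.log n < (M.Δ n ω : ℝ)}) atTop (𝓝 0) := by
      have h1 : Tendsto (fun n : ℕ => ENNReal.ofReal (3 * (n : ℝ) ^ (-1 : ℝ))) atTop (𝓝 0) := by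
        have h2 := ENNReal.tendsto_ofReal (((tendsto_rpow_neg_atTop (zero_lt_one (α := ℝ))).comp
          tendsto_natCast_atTop_atTop).const_mul 3)
        rwa [mul_zero, ENNReal.ofReal_zero] at h2
      exact tendsto_of_tendsto_of_tendsto_of_le_of_le' tendsto_const_nhds h1
        (Eventually.of_forall fun _ => zero_le) (hA M)
    have hbad := hup.add (hc M)
    rw [add_zero] at hbad
    have hlow := ENNReal.Tendsto.sub (tendsto_const_nhds (x := (1 : ENNReal))) hbad (by simp)
    rw [tsub_zero] at hlow
    refine tendsto_of_tendsto_of_tendsto_of_le_of_le' hlow tendsto_const_nhds ?_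
      (Eventually.of_forall fun n => prob_le_one)
    filter_upwards [tendsto_log_natCast.eventually_gt_atTop 0] with n hn
    -- `Δ` need not be measurable, so subadditivity of outer measure replaces complements.
    rw [tsub_le_iff_right]
    calc (1 : ENNReal) = M.P n Set.univ := measure_univ.symm
      _ ≤ M.P n ({ω | (A + c⁻¹ + 1)⁻¹ < (M.Δ n ω : ℝ) / Real.log n ∧
            (M.Δ n ω : ℝ) / Real.log n < A + c⁻¹ + 1} ∪
          ({ω | A * Real.log n < (M.Δ n ω : ℝ)} ∪ {ω | (M.Δ n ω : ℝ) < c * Real.log n})) := by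
        refine measure_mono fun ω _ => ?_
        by_contra hω
        simp only [Set.mem_union, Set.mem_ofPred_eq, not_or, not_lt] at hω
        obtain ⟨h1, h2, h3⟩ := hω
        exact h1 ⟨hC1.trans_le ((le_div_iff₀ hn).2 h3), ((div_le_iff₀ hn).2 h2).trans_lt hC2⟩
      _ ≤ _ := (measure_union_le _ _).trans (by gcongr; exact measure_union_le _ _)
  · obtain ⟨A, hA0, hA⟩ := RandomBipartiteMST.exists_measure_mul_log_lt_le hd hα0 hα1 ha
    refine ⟨max A 3, lt_max_of_lt_left hA0, fun M => ?_⟩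
    filter_upwards [hA M, tendsto_log_natCast.eventually_ge_atTop 0] with n hn hL
    refine (measure_mono fun ω hω => ?_).trans (hn.trans (ENNReal.ofReal_le_ofReal ?_))
    · exact lt_of_le_of_lt (mul_le_mul_of_nonneg_right (le_max_left _ _) hL) hω
    · gcongr
      exact le_max_right _ _
  · obtain ⟨A, hA0, hA⟩ := RandomBipartiteMST.exists_measure_mul_log_lt_le hd hα0 hα1 hq
    refine ⟨A ^ q + 3, by positivity, fun M => ?_⟩
    filter_upwards [hA M, tendsto_log_natCast.eventually_ge_atTop 1] with n hn hL
    exact M.lintegral_rpow_le hA0.le (by norm_num) hq hL hn
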